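/- **Model.** There are $N$ transmitter–receiver pairs; transmitters have $N_t$ antennas, receivers $N_r$, and each pair has $d\ge 1$ data streams. Let $P,\zeta,\sigma,R>0$ be the transmit power, the common path loss coefficient, the noise standard deviation and the rate of a successful stream, let $\tau\ge 0$ be the SINR threshold, and put $\alpha=P\zeta/d$. Let $\theta>0$ with $N\theta<1$ be the fraction of a slot needed to acquire the channel state of one user. Time is slotted. In every slot the matrices $H_{ki}\in\mathbb C^{N_r\times N_t}$ ($1\le k,i\le N$) have i.i.d. circularly symmetric complex Gaussian entries of mean $0$ and variance $1$, independently over slots. With unlimited backhaul, a set $\mathcal L$ of active pairs, with $L=|\mathcal L|$, uses precoders $v_i^{(j)}$ that are orthonormal in $j$ and unit combiners $u_k^{(m)}$ (measurable functions of the channels) satisfying almost surely the interference alignment conditions $(u_k^{(m)})^{H}H_{ki}v_i^{(j)}=0$ for all $i,k\in\mathcal L$ and $(i,j)\ne(k,m)$; such a scheme is assumed to exist, and is fixed, for every $\mathcal L$. The precoders are computed from the cross links $H_{ki}$, $k\neq i$ in $\mathcal L$, only. The combiner $u_k^{(m)}$ is computed from these and from the vectors $H_{kk}v_k^{(j)}$,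 $j\ne m$, only. The SINR of stream $m$ of user $k\in\mathcal L$ is $$\gamma_k^{(m)}=\frac{\alpha\,|(u_k^{(m)})^{H}H_{kk}v_k^{(m)}|^2}{\sigma^2+\sum_{i\in\mathcal L,\ (i,j)\neq(k,m)}\alpha\,|(u_k^{(m)})^{H}H_{ki}v_i^{(j)}|^2}.$$ User $k$ is offered $B_k=(1-L\theta)\,R\cdot\#\{m:\gamma_k^{(m)}\ge\tau\}$ bits in the slot if $k\in\mathcal L$, and $B_k=0$ otherwise. The queues start from some fixed $q(0)\in\mathbb R_{\ge0}^N$ and evolve by $$q_k(t+1)=\max\{q_k(t)-B_k(t),0\}+A_k(t).$$ The arrivals $A_k(t)\geq 0$ are bounded, i.i.d. in time, independent across users and of the channels, with mean vector $a=(\mathbb E A_k)_k$. A centralized policy chooses the active set of slot $t$ from the queue lengths up to time $t$, possibly with randomization, measurably. The system is strongly stable if $\limsup_{T}\frac1T\sum_{t<T}\mathbb E\,q_k(t)<\infty$ for every $k$. The stability region $\Lambda$ is the set of $a\in\mathbb R_{\ge 0}^N$ such that, for every arrival law with mean $a$, some centralized policy makes the system strongly stable. **Definitions.** Let $\mu(L)=(1-L\theta)\,dR\,e^{-\sigma^2\tau/\alpha}$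 and $\mu_T(L)=L\mu(L)$. Let $L_P=\lceil 1/(2\theta)\rceil$ if $\mu_T(\lceil 1/(2\theta)\rceil)\ge\mu_T(\lfloor 1/(2\theta)\rfloor)$, and $L_P=\lfloor 1/(2\theta)\rfloor$ otherwise. Let $P_L=\{\mu(L)s: s\in\{0,1\}^N,\ \|s\|_1=L\}$ (so $P_0=\{0\}$, and $P_L=\emptyset$ for $L>N$), and let $$\Lambda_P=\mathcal{CH}\{P_0,P_1,\dots,P_{L_P}\},$$ where $\mathcal{CH}$ denotes the closed convex hull. **Theorem.** For the symmetric system with unlimited backhaul the stability region is $\Lambda_P$, up to its boundary. Precisely: 1. the closure of $\Lambda$ is $\Lambda_P$; 2. every $a\in\mathbb R_{\ge0}^N$ that is interior to $\Lambda_P$ relative to $\mathbb R_{\ge0}^N$ belongs to $\Lambda$; 3. conversely, if for some arrival law some centralized policy makes the system strongly stable, then the mean vector of that law belongs to $\Lambda_P$. -/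

import Mathlib

open MeasureTheory ProbabilityTheory Filter Topology

namespace IAStability

noncomputable section

/-! ## Parameters of the symmetric system -/

/-- The parameters of the symmetric MIMO interference network. -/
structure SymmetricSystem where
  /-- maximum number of transmitter-receiver pairs -/
  N : ℕ
  /-- antennas at each transmitter -/
  Nt : ℕ
  /-- antennas at each receiver -/
  Nr : ℕ
  /-- data streams of each pair -/
  d : ℕ
  /-- total power of each transmitter -/
  P : ℝ
  /-- common path loss coefficient -/
  ζ : ℝ
  /-- standard deviation of the noise -/
  σ : ℝ
  /-- fraction of a slot spent to acquire the channel state information of one user -/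
  θ : ℝ
  /-- SINR threshold -/
  τ : ℝ
  /-- rate assigned to a stream whose SINR reaches the threshold -/
  R : ℝ
  d_pos : 0 < d
  P_pos : 0 < P
  ζ_pos : 0 < ζ
  σ_pos : 0 < σ
  θ_pos : 0 < θ
  τ_nonneg : 0 ≤ τ
  R_pos : 0 < R
  Nθ_lt_one : N * θ < 1

namespace SymmetricSystem

variable (M : SymmetricSystem)

/-- `α = P ζ / d`, the received power per stream. -/
def α : ℝ := M.P * M.ζ / M.d

/-! ## Channels -/

/-- All channel matrices of one slot: `H k i` is the `Nr × Nt` matrix from transmitter `i` to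
receiver `k`. -/
abbrev Channel : Type := Fin M.N → Fin M.N → Fin M.Nr → Fin M.Nt → ℂ

end SymmetricSystem

/-- The circularly symmetric complex Gaussian law with zero mean and unit variance. -/
def complexGaussian : Measure ℂ :=
  ((gaussianReal 0 (1 / 2)).prod (gaussianReal 0 (1 / 2))).map Complex.measurableEquivRealProd.symm

instance : IsProbabilityMeasure complexGaussian :=
  Measure.isProbabilityMeasure_map Complex.measurableEquivRealProd.symm.measurable.aemeasurable

namespace SymmetricSystem

variable (M : SymmetricSystem)

/-- All entries of all channel matrices are i.i.d. standard complex Gaussian. -/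
def channelLaw : Measure M.Channel :=
  Measure.pi fun _ => Measure.pi fun _ => Measure.pi fun _ => Measure.pi fun _ => complexGaussian

instance : IsProbabilityMeasure M.channelLaw := by
  unfold channelLaw; infer_instance

/-- The scalar `uᴴ G v`. -/
def gain (u : Fin M.Nr → ℂ) (G : Fin M.Nr → Fin M.Nt → ℂ) (v : Fin M.Nt → ℂ) : ℂ :=
  star u ⬝ᵥ (Matrix.of G).mulVec v

/-! ## Interference alignment with perfect channel knowledge -/

/-- An interference alignment scheme under unlimited backhaul. For every set `ℒ` of active pairs
and every realization `H` of the channels it provides the precoders `v ℒ H i j` and the combiners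
`u ℒ H k m`, for transmitter `i`, receiver `k` and streams `j`, `m`. -/
structure IAScheme where
  v : Finset (Fin M.N) → M.Channel → Fin M.N → Fin M.d → Fin M.Nt → ℂ
  u : Finset (Fin M.N) → M.Channel → Fin M.N → Fin M.d → Fin M.Nr → ℂ
  measurable_v : ∀ ℒ i j, Measurable fun H => v ℒ H i j
  measurable_u : ∀ ℒ k m, Measurable fun H => u ℒ H k m
  /-- the precoders of one transmitter are orthonormal (in particular of unit norm) -/
  orthonormal_v : ∀ ℒ H, ∀ i ∈ ℒ, ∀ j j',
    star (v ℒ H i j) ⬝ᵥ v ℒ H i j' = if j = j' then 1 else 0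
  /-- the combiners have unit norm -/
  unit_u : ∀ ℒ H, ∀ k ∈ ℒ, ∀ m, star (u ℒ H k m) ⬝ᵥ u ℒ H k m = 1
  /-- the alignment conditions: inter-stream and inter-user interference vanish -/
  aligned : ∀ ℒ, ∀ᵐ H ∂M.channelLaw, ∀ k ∈ ℒ, ∀ i ∈ ℒ, ∀ m j, (i, j) ≠ (k, m) →
    M.gain (u ℒ H k m) (H k i) (v ℒ H i j) = 0
  /-- the direct links do not enter in the computation of the precoders, which depends only on
  the cross links between active pairs -/
  v_congr : ∀ ℒ H H', (∀ k ∈ ℒ, ∀ i ∈ ℒ, k ≠ i → H k i = H' k i) →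
    ∀ i ∈ ℒ, ∀ j, v ℒ H i j = v ℒ H' i j
  /-- the direct link of receiver `k` enters in its zero-forcing combiner for stream `m` only
  through the directions in which the other streams of the same pair are received -/
  u_congr : ∀ ℒ H H', (∀ k ∈ ℒ, ∀ i ∈ ℒ, k ≠ i → H k i = H' k i) →
    ∀ k ∈ ℒ, ∀ m,
      (∀ j, j ≠ m →
        (Matrix.of (H k k)).mulVec (v ℒ H k j) = (Matrix.of (H' k k)).mulVec (v ℒ H k j)) →
      u ℒ H k m = u ℒ H' k m

variable {M}

namespace IAScheme

variable (S : M.IAScheme)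

/-- The SINR `γ_k^(m)` of stream `m` at the active receiver `k`. -/
def sinr (ℒ : Finset (Fin M.N)) (H : M.Channel) (k : Fin M.N) (m : Fin M.d) : ℝ :=
  M.α * ‖M.gain (S.u ℒ H k m) (H k k) (S.v ℒ H k m)‖ ^ 2 /
    (M.σ ^ 2 + ∑ i ∈ ℒ, ∑ j : Fin M.d,
      if (i, j) = (k, m) then 0
      else M.α * ‖M.gain (S.u ℒ H k m) (H k i) (S.v ℒ H i j)‖ ^ 2)

open Classical in
/-- `B_k`, the number of bits of user `k` that can be served in a slot with active set `ℒ` and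
channels `H`: the fraction `1 - |ℒ| θ` of the slot is left for transmission, and each stream
carries rate `R` if its SINR reaches the threshold, and `0` otherwise. -/
def service (ℒ : Finset (Fin M.N)) (H : M.Channel) (k : Fin M.N) : ℝ :=
  if k ∈ ℒ then
    (1 - ℒ.card * M.θ) * ∑ m : Fin M.d, if M.τ ≤ S.sinr ℒ H k m then M.R else 0
  else 0

end IAScheme

/-! ## Arrivals, scheduling policies and queues -/

end SymmetricSystem

/-- The laws of the numbers of bits that arrive in one slot for each of the `N` users; they are
nonnegative and bounded. The arrivals are independent across users. -/
structure ArrivalLaw (N : ℕ) where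
  law : Fin N → Measure ℝ
  prob : ∀ k, IsProbabilityMeasure (law k)
  bounded : ∃ Amax : ℝ, ∀ k, ∀ᵐ x ∂law k, 0 ≤ x ∧ x < Amax

namespace ArrivalLaw

variable {N : ℕ} (A : ArrivalLaw N)

instance (k : Fin N) : IsProbabilityMeasure (A.law k) := A.prob k

/-- The vector of mean arrival rates, in bits per slot. -/
def mean (k : Fin N) : ℝ := ∫ x, x ∂A.law k

end ArrivalLaw

/-- A centralized scheduling policy. At slot `t` it selects the set of active pairs from the queue
lengths at the slots `0, …, t` and a random seed. -/
structure Policy (N : ℕ) where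
  select : (t : ℕ) → (Fin (t + 1) → Fin N → ℝ) → unitInterval → Finset (Fin N)
  measurable_select : ∀ t, Measurable fun x : (Fin (t + 1) → Fin N → ℝ) × unitInterval =>
    select t x.1 x.2

namespace SymmetricSystem

variable {M : SymmetricSystem}

/-- The randomness of one slot: arrivals, channels, and the seed of the policy. -/
abbrev Slot (M : SymmetricSystem) : Type := (Fin M.N → ℝ) × M.Channel × unitInterval

/-- Arrivals, channels and seed of a slot are independent. -/
def slotLaw (A : ArrivalLaw M.N) : Measure M.Slot :=
  (Measure.pi A.law).prod (M.channelLaw.prod volume)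

instance (A : ArrivalLaw M.N) : IsProbabilityMeasure (slotLaw A) := by
  unfold slotLaw; infer_instance

/-- The slots are i.i.d. -/
def pathLaw (A : ArrivalLaw M.N) : Measure (ℕ → M.Slot) :=
  Measure.infinitePi fun _ => slotLaw A

namespace IAScheme

variable (S : M.IAScheme)

/-- The queue lengths at the slots `0, …, t`, started from `q₀`, which evolve by
`q_k(t+1) = max {q_k(t) - B_k(t), 0} + A_k(t)`. -/
def history (π : Policy M.N) (q₀ : Fin M.N → ℝ) (ω : ℕ → M.Slot) :
    (t : ℕ) → Fin (t + 1) → Fin M.N → ℝ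
  | 0 => fun _ => q₀
  | t + 1 =>
    let h := history π q₀ ω t
    let ℒ := π.select t h (ω t).2.2
    Fin.snoc (α := fun _ => Fin M.N → ℝ) h fun k =>
      max (h (Fin.last t) k - S.service ℒ (ω t).2.1 k) 0 + (ω t).1 k

/-- The queue length vector at slot `t`. -/
def queue (π : Policy M.N) (q₀ : Fin M.N → ℝ) (ω : ℕ → M.Slot) (t : ℕ) : Fin M.N → ℝ :=
  S.history π q₀ ω t (Fin.last t)

/-- Strong stability: `limsup_T (1/T) ∑_{t<T} E[q_k(t)] < ∞` for every user `k`. -/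
def StronglyStable (A : ArrivalLaw M.N) (q₀ : Fin M.N → ℝ) (π : Policy M.N) : Prop :=
  ∀ k, limsup (fun T : ℕ => (∑ t ∈ Finset.range T,
    ∫⁻ ω, ENNReal.ofReal (S.queue π q₀ ω t k) ∂pathLaw A) / (T : ENNReal)) atTop < ⊤

/-- Some centralized policy makes all queues strongly stable under the arrival law `A`. -/
def Stabilizable (q₀ : Fin M.N → ℝ) (A : ArrivalLaw M.N) : Prop :=
  ∃ π : Policy M.N, S.StronglyStable A q₀ π

/-- The set of mean arrival rate vectors for which all the queues can be made strongly stable,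
whatever the arrival law with these means. -/
def stabilityRegion (q₀ : Fin M.N → ℝ) : Set (Fin M.N → ℝ) :=
  {a | (∀ k, 0 ≤ a k) ∧ ∀ A : ArrivalLaw M.N, A.mean = a → S.Stabilizable q₀ A}

end IAScheme

/-! ## The characterization -/

variable (M)

/-- `μ(L) = (1 - L θ) d R exp(-σ² τ / α)`. -/
def μ (L : ℕ) : ℝ := (1 - L * M.θ) * M.d * M.R * Real.exp (-(M.σ ^ 2 * M.τ / M.α))

/-- `μ_T(L) = L μ(L)`. -/
def μT (L : ℕ) : ℝ := L * M.μ L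

/-- The best of the two integers next to `1 / (2 θ)`. -/
def LP : ℕ :=
  if M.μT ⌊1 / (2 * M.θ)⌋₊ ≤ M.μT ⌈1 / (2 * M.θ)⌉₊ then ⌈1 / (2 * M.θ)⌉₊ else ⌊1 / (2 * M.θ)⌋₊

/-- `S_L`, the decision vectors `s ∈ {0,1}^N` with `‖s‖₁ = L`. -/
def decisions (L : ℕ) : Set (Fin M.N → ℝ) :=
  {s | (∀ k, s k = 0 ∨ s k = 1) ∧ ∑ k, |s k| = L}

/-- `P_L = {μ(L) s : s ∈ S_L}`. -/
def rateVectors (L : ℕ) : Set (Fin M.N → ℝ) := (fun s => M.μ L • s) '' M.decisions L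

/-- `Λ_P`, the closed convex hull of `P_0 = {0}, P_1, …, P_{L_P}`. -/
def regionP : Set (Fin M.N → ℝ) := closedConvexHull ℝ (⋃ L ∈ Set.Iic M.LP, M.rateVectors L)

end SymmetricSystem

end

end IAStability

/-!
Fix an active set `ℒ` and a stream `m` of a user `k ∈ ℒ`. Resampling the component of the direct
link `H k k` along the precoder `v_k^{(m)}` preserves the channel law, because Gaussian laws are
rotation invariant, and changes neither the precoder nor the combiner. Hence the desired gain is a
standard complex Gaussian; there is no interference, so each stream succeeds with probability
`exp (-σ² τ / α)`, and the mean service of `ℒ` is `μ(|ℒ|) 1_ℒ`. Sets with more than `L_P` elements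
do not enlarge `Λ_P`: the uniform distribution on a set is a mixture of the uniform distributions on
its subsets of size `L_P`, and `L_P` maximizes `μ_T`.

Under a stable policy the expected queue lengths at time `T` are at most `ε T` for some `T > 0`,
however small `ε > 0`, so the arrival rate is bounded, up to the error `ε`, by a time average of
expected service rates; these lie in `Λ_P`, which is closed, convex and downward closed in the
orthant. Conversely, if the arrival rate plus
some `ε > 0` in every coordinate lies in `Λ_P`, then max-weight scheduling gives the quadratic
Lyapunov function a drift of at most a constant minus `2 ε` times the total queue length.
-/

namespace IAStability

noncomputable section

/-! ### Resampling -/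

section Resampling

variable {Ω Y : Type*} [MeasurableSpace Ω] [MeasurableSpace Y] {P : Measure Ω} {ν : Measure Y}
  [SFinite ν] {T : Ω × Y → Ω}

lemma map_eq_of_forall_map_resample {Z : Type*} [MeasurableSpace Z] {ρ : Measure Z}
    [IsProbabilityMeasure P] (hT : MeasurePreserving T (P.prod ν) P) {f : Ω → Z}
    (hf : Measurable f) (h : ∀ ω, ν.map (fun y => f (T (ω, y))) = ρ) : P.map f = ρ := by
  ext s hs
  have hfT : Measurable (f ∘ T) := hf.comp hT.measurable
  have hslice (ω : Ω) : ν (Prod.mk ω ⁻¹' ((f ∘ T) ⁻¹' s)) = ρ s := by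
    rw [← h ω]
    exact (Measure.map_apply (hfT.comp measurable_prodMk_left) hs).symm
  rw [← hT.map_eq, Measure.map_map hf hT.measurable, Measure.map_apply hfT hs,
    Measure.prod_apply (hfT hs), lintegral_congr hslice, lintegral_const, measure_univ, mul_one]

lemma integral_resample {E : Type*} [NormedAddCommGroup E] [NormedSpace ℝ E] [SFinite P]
    (hT : MeasurePreserving T (P.prod ν) P) {f : Ω → E} (hf : Integrable f P) :
    ∫ ω, f ω ∂P = ∫ ω, ∫ y, f (T (ω, y)) ∂ν ∂P := by
  have hmap : AEStronglyMeasurable f ((P.prod ν).map T) := by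
    rw [hT.map_eq]; exact hf.aestronglyMeasurable
  calc ∫ ω, f ω ∂P = ∫ p, f (T p) ∂P.prod ν := by
        rw [← integral_map hT.measurable.aemeasurable hmap, hT.map_eq]
    _ = ∫ ω, ∫ y, f (T (ω, y)) ∂ν ∂P :=
        integral_prod _ ((hT.integrable_comp hf.aestronglyMeasurable).2 hf)

end Resampling

section Update

variable {ι : Type*} {X : ι → Type*} [∀ i, MeasurableSpace (X i)] (μ : ∀ i, Measure (X i))
  [∀ i, IsProbabilityMeasure (μ i)]

lemma measurePreserving_update_infinitePi [DecidableEq ι] (i : ι) :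
    MeasurePreserving (fun p : (∀ j, X j) × X i => Function.update p.1 i p.2)
      ((Measure.infinitePi μ).prod (μ i)) (Measure.infinitePi μ) := by
  refine ⟨by fun_prop, Measure.eq_infinitePi _ fun s B hB => ?_⟩
  have hpre : (fun p : (∀ j, X j) × X i => Function.update p.1 i p.2) ⁻¹' Set.pi s B
      = Set.pi (s.erase i) B ×ˢ (if i ∈ s then B i else Set.univ) := by
    ext ⟨ω, x⟩
    simp only [Set.mem_preimage, Set.mem_pi, Finset.mem_coe, Set.mem_prod, Finset.mem_erase]
    constructor
    · intro h
      refine ⟨fun j hj => by simpa [hj.1] using h j hj.2, ?_⟩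
      split_ifs with hi
      · simpa using h i hi
      · trivial
    · rintro ⟨hω, hx⟩ j hj
      rcases eq_or_ne j i with rfl | hji
      · simpa [hj] using hx
      · simpa [hji] using hω j ⟨hji, hj⟩
  rw [Measure.map_apply (by fun_prop) (MeasurableSet.pi s.countable_toSet fun j _ => hB j), hpre,
    Measure.prod_prod, Measure.infinitePi_pi _ fun j _ => hB j]
  split_ifs with hi
  · exact Finset.prod_erase_mul _ (fun j => μ j (B j)) hi
  · rw [Finset.erase_eq_of_notMem hi, measure_univ, mul_one]

lemma measurePreserving_update_pi [Fintype ι] [DecidableEq ι] (i : ι) :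
    MeasurePreserving (fun p : (∀ j, X j) × X i => Function.update p.1 i p.2)
      ((Measure.pi μ).prod (μ i)) (Measure.pi μ) := by
  simpa only [Measure.infinitePi_eq_pi] using measurePreserving_update_infinitePi μ i

end Update

/-! ### Complex Gaussian vectors -/

lemma integral_cexp_re_mul_complexGaussian (c : ℂ) :
    ∫ z, Complex.exp ((c * z).re * Complex.I) ∂complexGaussian
      = Complex.exp (-(‖c‖ ^ 2 / 4 : ℝ)) := by
  have hcoord (t : ℝ) : ∫ x : ℝ, Complex.exp (t * x * Complex.I) ∂gaussianReal 0 (1 / 2)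
      = Complex.exp (-(t ^ 2 / 4 : ℝ)) := by
    rw [← charFun_apply_real, charFun_gaussianReal]
    congr 1
    push_cast
    ring
  have hsplit (p : ℝ × ℝ) :
      Complex.exp ((c * Complex.measurableEquivRealProd.symm p).re * Complex.I)
        = Complex.exp (c.re * p.1 * Complex.I) * Complex.exp ((-c.im : ℝ) * p.2 * Complex.I) := by
    rw [← Complex.exp_add, Complex.mul_re]
    congr 1
    simp only [Complex.measurableEquivRealProd_symm_apply]
    push_cast
    ring
  rw [complexGaussian, integral_map_equiv]
  simp_rw [hsplit]
  rw [integral_prod_mul (fun x : ℝ => Complex.exp (c.re * x * Complex.I))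
    (fun y : ℝ => Complex.exp ((-c.im : ℝ) * y * Complex.I)), hcoord, hcoord, ← Complex.exp_add,
    Complex.sq_norm, Complex.normSq_apply]
  congr 1
  push_cast
  ring

variable {ι κ : Type*} [Fintype ι]

lemma integral_cexp_re_dotProduct_pi_complexGaussian (c : ι → ℂ) :
    ∫ x, Complex.exp ((c ⬝ᵥ x).re * Complex.I) ∂(Measure.pi fun _ : ι => complexGaussian)
      = Complex.exp (-((∑ i, ‖c i‖ ^ 2) / 4 : ℝ)) := by
  simp_rw [dotProduct, Complex.re_sum, Complex.ofReal_sum, Finset.sum_mul, Complex.exp_sum]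
  rw [integral_fintype_prod_eq_prod (𝕜 := ℂ)
    (fun i (z : ℂ) => Complex.exp ((c i * z).re * Complex.I))]
  simp_rw [integral_cexp_re_mul_complexGaussian]
  rw [← Complex.exp_sum, Finset.sum_neg_distrib, ← Complex.ofReal_sum, Finset.sum_div]

lemma ext_of_integral_cexp_re {E : Type*} [NormedAddCommGroup E] [NormedSpace ℂ E]
    [CompleteSpace E] [SecondCountableTopology E] [MeasurableSpace E] [BorelSpace E]
    {μ ν : Measure E} [IsFiniteMeasure μ] [IsFiniteMeasure ν]
    (h : ∀ L : StrongDual ℂ E, ∫ x, Complex.exp ((L x).re * Complex.I) ∂μ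
      = ∫ x, Complex.exp ((L x).re * Complex.I) ∂ν) : μ = ν := by
  refine Measure.ext_of_charFunDual (funext fun L => ?_)
  have hL (x : E) : L x = (StrongDual.extendRCLike (𝕜 := ℂ) L x).re := by
    rw [← RCLike.re_eq_complex_re, StrongDual.re_extendRCLike_apply]
  simpa only [charFunDual_apply, ← hL] using h (StrongDual.extendRCLike L)

lemma ext_of_integral_cexp_re_dotProduct {μ ν : Measure (ι → ℂ)} [IsFiniteMeasure μ]
    [IsFiniteMeasure ν]
    (h : ∀ c : ι → ℂ, ∫ x, Complex.exp ((c ⬝ᵥ x).re * Complex.I) ∂μ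
      = ∫ x, Complex.exp ((c ⬝ᵥ x).re * Complex.I) ∂ν) : μ = ν := by
  classical
  refine ext_of_integral_cexp_re fun L => ?_
  obtain ⟨c, hc⟩ : ∃ c : ι → ℂ, ∀ x, L x = c ⬝ᵥ x := by
    refine ⟨fun i => L (Pi.single i 1), fun x => ?_⟩
    conv_lhs => rw [pi_eq_sum_univ' x]
    simp [dotProduct, mul_comm]
  simp_rw [hc]
  exact h c

lemma star_dotProduct_self (x : ι → ℂ) : star x ⬝ᵥ x = (∑ i, ‖x i‖ ^ 2 : ℝ) := by
  simp [dotProduct, Complex.conj_mul']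

lemma sum_sq_norm_of_unit {x : ι → ℂ} (hx : star x ⬝ᵥ x = 1) : ∑ i, ‖x i‖ ^ 2 = 1 := by
  rw [star_dotProduct_self] at hx
  exact_mod_cast hx

lemma map_star_dotProduct_pi_complexGaussian {u : ι → ℂ} (hu : star u ⬝ᵥ u = 1) :
    (Measure.pi fun _ : ι => complexGaussian).map (fun z => star u ⬝ᵥ z) = complexGaussian := by
  have hmeas : Measurable fun z : ι → ℂ => star u ⬝ᵥ z := by
    unfold dotProduct; fun_prop
  have := Measure.isProbabilityMeasure_map (μ := Measure.pi fun _ : ι => complexGaussian)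
    hmeas.aemeasurable
  refine ext_of_integral_cexp_re fun L => ?_
  obtain ⟨c, hc⟩ : ∃ c : ℂ, ∀ z, L z = c * z :=
    ⟨L 1, fun z => by rw [mul_comm, ← smul_eq_mul, ← map_smul, smul_eq_mul, mul_one]⟩
  rw [integral_map hmeas.aemeasurable (by fun_prop)]
  simp_rw [hc, ← smul_eq_mul c (star u ⬝ᵥ _), ← smul_dotProduct,
    integral_cexp_re_dotProduct_pi_complexGaussian, integral_cexp_re_mul_complexGaussian]
  simp [mul_pow, ← Finset.mul_sum, sum_sq_norm_of_unit hu]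

/-- The matrix `G + (z - G w) wᴴ`: for a unit vector `w` it maps `w` to `z` and agrees with `G` on
the orthogonal complement of `w`. -/
def resampleDirection (w : ι → ℂ) (G : κ → ι → ℂ) (z : κ → ℂ) : κ → ι → ℂ :=
  fun r => G r + (z r - G r ⬝ᵥ w) • star w

lemma sum_sq_norm_sub_smul_add_sq_norm {w : ι → ℂ} (hw : star w ⬝ᵥ w = 1) (c : ι → ℂ) :
    ∑ i, ‖(c - (c ⬝ᵥ star w) • w) i‖ ^ 2 + ‖c ⬝ᵥ star w‖ ^ 2 = ∑ i, ‖c i‖ ^ 2 := by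
  set s := c ⬝ᵥ star w
  have hs : star c ⬝ᵥ w = star s := by
    rw [Matrix.star_dotProduct, dotProduct_comm]
  have hs' : star w ⬝ᵥ c = s := dotProduct_comm _ _
  have hss : star s * s = (‖s‖ ^ 2 : ℝ) := by simp [Complex.conj_mul']
  have h : star (c - s • w) ⬝ᵥ (c - s • w) + star s * s = star c ⬝ᵥ c := by
    simp only [star_sub, star_smul, sub_dotProduct, dotProduct_sub, smul_dotProduct,
      dotProduct_smul, smul_eq_mul, hs, hs', hw]
    ring
  rw [star_dotProduct_self, star_dotProduct_self, hss] at h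
  exact_mod_cast h

lemma measurePreserving_resampleDirection_row {w : ι → ℂ} (hw : star w ⬝ᵥ w = 1) :
    MeasurePreserving (fun p : (ι → ℂ) × ℂ => p.1 + (p.2 - p.1 ⬝ᵥ w) • star w)
      ((Measure.pi fun _ : ι => complexGaussian).prod complexGaussian)
      (Measure.pi fun _ : ι => complexGaussian) := by
  have hmeas : Measurable fun p : (ι → ℂ) × ℂ => p.1 + (p.2 - p.1 ⬝ᵥ w) • star w := by
    unfold dotProduct; fun_prop
  refine ⟨hmeas, ?_⟩
  have := Measure.isProbabilityMeasure_map
    (μ := (Measure.pi fun _ : ι => complexGaussian).prod complexGaussian) hmeas.aemeasurable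
  refine ext_of_integral_cexp_re_dotProduct fun c => ?_
  set s := c ⬝ᵥ star w with hs
  have hdot (p : (ι → ℂ) × ℂ) : c ⬝ᵥ (p.1 + (p.2 - p.1 ⬝ᵥ w) • star w)
      = (c - s • w) ⬝ᵥ p.1 + s * p.2 := by
    rw [dotProduct_add, dotProduct_smul, ← hs, sub_dotProduct, smul_dotProduct,
      dotProduct_comm w, smul_eq_mul, smul_eq_mul]
    ring
  rw [integral_map hmeas.aemeasurable
    (Continuous.aestronglyMeasurable (by unfold dotProduct; fun_prop))]
  simp_rw [hdot, Complex.add_re, Complex.ofReal_add, add_mul, Complex.exp_add]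
  rw [integral_prod_mul (fun x : ι → ℂ => Complex.exp (((c - s • w) ⬝ᵥ x).re * Complex.I))
    (fun z : ℂ => Complex.exp ((s * z).re * Complex.I)),
    integral_cexp_re_dotProduct_pi_complexGaussian, integral_cexp_re_mul_complexGaussian,
    integral_cexp_re_dotProduct_pi_complexGaussian, ← Complex.exp_add,
    ← sum_sq_norm_sub_smul_add_sq_norm hw c]
  congr 1
  push_cast
  ring

lemma measurePreserving_resampleDirection [Fintype κ] {w : ι → ℂ} (hw : star w ⬝ᵥ w = 1) :
    MeasurePreserving (fun p : (κ → ι → ℂ) × (κ → ℂ) => resampleDirection w p.1 p.2)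
      ((Measure.pi fun _ : κ => Measure.pi fun _ : ι => complexGaussian).prod
        (Measure.pi fun _ : κ => complexGaussian))
      (Measure.pi fun _ : κ => Measure.pi fun _ : ι => complexGaussian) := by
  have hrows := measurePreserving_pi (ι := κ) (fun _ => _) (fun _ => _)
    fun _ => measurePreserving_resampleDirection_row hw
  exact hrows.comp (measurePreserving_arrowProdEquivProdArrow (ι → ℂ) ℂ κ
    (fun _ => Measure.pi fun _ : ι => complexGaussian) fun _ => complexGaussian).symm

lemma resampleDirection_mulVec_self {w : ι → ℂ} (hw : star w ⬝ᵥ w = 1) (G : κ → ι → ℂ)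
    (z : κ → ℂ) : (Matrix.of (resampleDirection w G z)).mulVec w = z := by
  refine funext fun r => ?_
  change (G r + (z r - G r ⬝ᵥ w) • star w) ⬝ᵥ w = z r
  rw [add_dotProduct, smul_dotProduct, hw, smul_eq_mul, mul_one, add_sub_cancel]

lemma resampleDirection_mulVec_of_orthogonal {w x : ι → ℂ} (hx : star w ⬝ᵥ x = 0)
    (G : κ → ι → ℂ) (z : κ → ℂ) :
    (Matrix.of (resampleDirection w G z)).mulVec x = (Matrix.of G).mulVec x := by
  refine funext fun r => ?_
  change (G r + (z r - G r ⬝ᵥ w) • star w) ⬝ᵥ x = G r ⬝ᵥ x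
  rw [add_dotProduct, smul_dotProduct, hx, smul_zero, add_zero]

/-! ### The Rayleigh tail -/

lemma complexGaussian_eq_withDensity :
    complexGaussian = (volume : Measure ℂ).withDensity
      (fun z => ENNReal.ofReal (Real.pi⁻¹ * Real.exp (-‖z‖ ^ 2))) := by
  have hdens (x y : ℝ) : gaussianPDFReal 0 (1 / 2) x * gaussianPDFReal 0 (1 / 2) y
      = Real.pi⁻¹ * Real.exp (-‖Complex.measurableEquivRealProd.symm (x, y)‖ ^ 2) := by
    have hvar : 2 * Real.pi * ((1 / 2 : NNReal) : ℝ) = Real.pi := by push_cast; ring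
    rw [gaussianPDFReal, gaussianPDFReal, hvar, mul_mul_mul_comm, ← mul_inv,
      Real.mul_self_sqrt Real.pi_pos.le, ← Real.exp_add, Complex.sq_norm, Complex.normSq_apply]
    congr 2
    simp only [Complex.measurableEquivRealProd_symm_apply]
    push_cast
    ring
  rw [complexGaussian, gaussianReal_of_var_ne_zero _ (by norm_num),
    prod_withDensity (by fun_prop) (by fun_prop)]
  ext s hs
  rw [Measure.map_apply (MeasurableEquiv.measurable _) hs,
    withDensity_apply _ (MeasurableEquiv.measurable _ hs), withDensity_apply _ hs,
    ← (Complex.volume_preserving_equiv_real_prod.symm).setLIntegral_comp_preimage_emb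
      Complex.measurableEquivRealProd.symm.measurableEmbedding]
  refine lintegral_congr fun p => ?_
  rw [gaussianPDF, gaussianPDF, ← ENNReal.ofReal_mul (gaussianPDFReal_nonneg _ _ _), hdens]

lemma integral_Ioi_mul_exp_neg_sq {t : ℝ} (ht : 0 ≤ t) :
    ∫ r in Set.Ioi t, 2 * r * Real.exp (-r ^ 2) = Real.exp (-t ^ 2) := by
  have hderiv (r : ℝ) : HasDerivAt (fun r : ℝ => -Real.exp (-r ^ 2))
      (2 * r * Real.exp (-r ^ 2)) r :=
    ((hasDerivAt_pow 2 r).neg.exp.neg).congr_deriv (by simp; ring)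
  have hlim : Tendsto (fun r : ℝ => -Real.exp (-r ^ 2)) atTop (𝓝 0) := by
    simpa using (Real.tendsto_exp_neg_atTop_nhds_zero.comp (tendsto_pow_atTop two_ne_zero)).neg
  have hnonneg : ∀ r ∈ Set.Ioi t, 0 ≤ 2 * r * Real.exp (-r ^ 2) := fun r hr =>
    mul_nonneg (mul_nonneg zero_le_two (ht.trans hr.le)) (Real.exp_pos _).le
  rw [integral_Ioi_of_hasDerivAt_of_nonneg' (fun r _ => hderiv r) hnonneg hlim]
  ring

lemma setIntegral_norm_ge_fun_norm (f : ℝ → ℝ) {t : ℝ} (ht : 0 ≤ t) :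
    ∫ z in {z : ℂ | t ≤ ‖z‖}, f ‖z‖ = 2 * Real.pi * ∫ r in Set.Ioi t, r * f r := by
  have hmeas : MeasurableSet {z : ℂ | t ≤ ‖z‖} := measurableSet_le (by fun_prop) (by fun_prop)
  have hradial (z : ℂ) : {z : ℂ | t ≤ ‖z‖}.indicator (fun z => f ‖z‖) z
      = (Set.Ici t).indicator f ‖z‖ := by
    simp [Set.indicator_apply]
  have hweight (r : ℝ) :
      r * (Set.Ici t).indicator f r = (Set.Ici t).indicator (fun r => r * f r) r := by
    simp [Set.indicator_apply]
  have hdisc : (volume : Measure ℂ).real (Metric.ball 0 1) = Real.pi := by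
    simp [measureReal_def]
  have hset : (Set.Ioi 0 ∩ Set.Ici t : Set ℝ) =ᵐ[volume] Set.Ioi t := by
    have h := (ae_eq_refl (μ := volume) (Set.Ioi (0 : ℝ))).inter (Ioi_ae_eq_Ici (a := t)).symm
    rwa [Set.Ioi_inter_Ioi, sup_of_le_right ht] at h
  rw [← integral_indicator hmeas]
  simp_rw [hradial]
  rw [integral_fun_norm_addHaar]
  simp only [Complex.finrank_real_complex, Nat.add_one_sub_one, pow_one, smul_eq_mul, hweight]
  rw [setIntegral_indicator measurableSet_Ici, setIntegral_congr_set hset, hdisc, nsmul_eq_mul,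
    Nat.cast_ofNat, mul_assoc]

lemma complexGaussian_real_norm_ge {t : ℝ} (ht : 0 ≤ t) :
    complexGaussian.real {z | t ≤ ‖z‖} = Real.exp (-t ^ 2) := by
  have hmeas : MeasurableSet {z : ℂ | t ≤ ‖z‖} := measurableSet_le (by fun_prop) (by fun_prop)
  calc complexGaussian.real {z | t ≤ ‖z‖}
      = ∫ z in {z : ℂ | t ≤ ‖z‖}, Real.pi⁻¹ * Real.exp (-‖z‖ ^ 2) := by
        rw [measureReal_def, complexGaussian_eq_withDensity, withDensity_apply _ hmeas,
          integral_eq_lintegral_of_nonneg_ae (ae_of_all _ fun z => by positivity) (by fun_prop)]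
    _ = 2 * Real.pi * ∫ r in Set.Ioi t, r * (Real.pi⁻¹ * Real.exp (-r ^ 2)) :=
        setIntegral_norm_ge_fun_norm (fun r => Real.pi⁻¹ * Real.exp (-r ^ 2)) ht
    _ = ∫ r in Set.Ioi t, 2 * r * Real.exp (-r ^ 2) := by
        rw [← integral_const_mul]
        congr 1 with r
        field_simp
    _ = Real.exp (-t ^ 2) := integral_Ioi_mul_exp_neg_sq ht

/-! ### The mean service of an active set -/

namespace SymmetricSystem

variable {M : SymmetricSystem}

lemma α_pos (M : SymmetricSystem) : 0 < M.α :=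
  div_pos (mul_pos M.P_pos M.ζ_pos) (Nat.cast_pos.2 M.d_pos)

/-- The channels `H` with the direct link of user `k` replaced by `G`. -/
def setDirect (H : M.Channel) (k : Fin M.N) (G : Fin M.Nr → Fin M.Nt → ℂ) : M.Channel :=
  Function.update H k (Function.update (H k) k G)

lemma setDirect_self (H : M.Channel) (k : Fin M.N) (G : Fin M.Nr → Fin M.Nt → ℂ) :
    setDirect H k G k k = G := by
  simp [setDirect]

lemma setDirect_of_ne (H : M.Channel) (k : Fin M.N) (G : Fin M.Nr → Fin M.Nt → ℂ)
    {j i : Fin M.N} (h : j ≠ i) : setDirect H k G j i = H j i := by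
  rcases eq_or_ne j k with rfl | hj
  · simp [setDirect, h.symm]
  · simp [setDirect, hj]

lemma measurable_setDirect (H : M.Channel) (k : Fin M.N) : Measurable (setDirect H k) := by
  unfold setDirect
  fun_prop

lemma map_eq_of_forall_map_setDirect (k : Fin M.N) {Z : Type*} [MeasurableSpace Z]
    {ρ : Measure Z} {f : M.Channel → Z} (hf : Measurable f)
    (h : ∀ H, (Measure.pi fun _ : Fin M.Nr => Measure.pi fun _ : Fin M.Nt => complexGaussian).map
      (fun G => f (setDirect H k G)) = ρ) : M.channelLaw.map f = ρ := by
  refine map_eq_of_forall_map_resample (measurePreserving_update_pi _ k) hf fun H => ?_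
  refine map_eq_of_forall_map_resample (measurePreserving_update_pi _ k) (by fun_prop) fun r => ?_
  simpa [setDirect] using h (Function.update H k r)

namespace IAScheme

variable (S : M.IAScheme) (ℒ : Finset (Fin M.N))

lemma measurable_gain (k i : Fin M.N) (m j : Fin M.d) :
    Measurable fun H => M.gain (S.u ℒ H k m) (H k i) (S.v ℒ H i j) := by
  have hu := S.measurable_u ℒ k m
  have hv := S.measurable_v ℒ i j
  simp only [gain, dotProduct, Matrix.mulVec, Pi.star_apply, Matrix.of_apply]
  fun_prop

variable {ℒ} {k : Fin M.N}

lemma v_setDirect (hk : k ∈ ℒ) (H : M.Channel) (G : Fin M.Nr → Fin M.Nt → ℂ) (j : Fin M.d) :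
    S.v ℒ (setDirect H k G) k j = S.v ℒ H k j :=
  S.v_congr ℒ _ _ (fun _ _ _ _ h => setDirect_of_ne H k G h) k hk j

lemma unit_v (hk : k ∈ ℒ) (H : M.Channel) (m : Fin M.d) :
    star (S.v ℒ H k m) ⬝ᵥ S.v ℒ H k m = 1 := by
  rw [S.orthonormal_v ℒ H k hk, if_pos rfl]

lemma u_setDirect_resampleDirection (hk : k ∈ ℒ) (H : M.Channel) (m : Fin M.d)
    (G : Fin M.Nr → Fin M.Nt → ℂ) (z : Fin M.Nr → ℂ) :
    S.u ℒ (setDirect H k (resampleDirection (S.v ℒ H k m) G z)) k m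
      = S.u ℒ (setDirect H k G) k m := by
  refine S.u_congr ℒ _ _ (fun k' _ i' _ h => ?_) k hk m fun j hj => ?_
  · rw [setDirect_of_ne _ _ _ h, setDirect_of_ne _ _ _ h]
  · have horth : star (S.v ℒ H k m) ⬝ᵥ S.v ℒ H k j = 0 := by
      rw [S.orthonormal_v ℒ H k hk, if_neg hj.symm]
    rw [S.v_setDirect hk, setDirect_self, setDirect_self,
      resampleDirection_mulVec_of_orthogonal horth]

lemma gain_setDirect_resampleDirection (hk : k ∈ ℒ) (H : M.Channel) (m : Fin M.d)
    (G : Fin M.Nr → Fin M.Nt → ℂ) (z : Fin M.Nr → ℂ) :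
    (fun H' => M.gain (S.u ℒ H' k m) (H' k k) (S.v ℒ H' k m))
        (setDirect H k (resampleDirection (S.v ℒ H k m) G z))
      = star (S.u ℒ (setDirect H k G) k m) ⬝ᵥ z := by
  simp only [gain]
  rw [S.u_setDirect_resampleDirection hk, S.v_setDirect hk, setDirect_self,
    resampleDirection_mulVec_self (S.unit_v hk H m)]

lemma map_gain_direct (hk : k ∈ ℒ) (m : Fin M.d) :
    M.channelLaw.map (fun H => M.gain (S.u ℒ H k m) (H k k) (S.v ℒ H k m)) = complexGaussian := by
  have hgain := S.measurable_gain ℒ k k m m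
  refine map_eq_of_forall_map_setDirect k hgain fun H => ?_
  refine map_eq_of_forall_map_resample (measurePreserving_resampleDirection (S.unit_v hk H m))
    (hgain.comp (measurable_setDirect H k)) fun G => ?_
  simp only [S.gain_setDirect_resampleDirection hk H m G]
  exact map_star_dotProduct_pi_complexGaussian (S.unit_u ℒ _ k hk m)

variable (ℒ k) in
lemma measurable_sinr (m : Fin M.d) : Measurable fun H => S.sinr ℒ H k m := by
  refine Measurable.div (((S.measurable_gain ℒ k k m m).norm.pow_const 2).const_mul _)
    (measurable_const.add
      (Finset.measurable_sum _ fun i _ => Finset.measurable_sum _ fun j _ => ?_))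
  split_ifs
  · exact measurable_const
  · exact ((S.measurable_gain ℒ k i m j).norm.pow_const 2).const_mul _

lemma sinr_ae_eq (hk : k ∈ ℒ) (m : Fin M.d) : ∀ᵐ H ∂M.channelLaw, S.sinr ℒ H k m
    = M.α * ‖M.gain (S.u ℒ H k m) (H k k) (S.v ℒ H k m)‖ ^ 2 / M.σ ^ 2 := by
  filter_upwards [S.aligned ℒ] with H hH
  have hinterference : ∑ i ∈ ℒ, ∑ j : Fin M.d, (if (i, j) = (k, m) then 0
      else M.α * ‖M.gain (S.u ℒ H k m) (H k i) (S.v ℒ H i j)‖ ^ 2) = 0 := by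
    refine Finset.sum_eq_zero fun i hi => Finset.sum_eq_zero fun j _ => ?_
    split_ifs with h
    · rfl
    · rw [hH k hk i hi m j h, norm_zero, zero_pow two_ne_zero, mul_zero]
  rw [sinr, hinterference, add_zero]

lemma channelLaw_real_le_sinr (hk : k ∈ ℒ) (m : Fin M.d) :
    M.channelLaw.real {H | M.τ ≤ S.sinr ℒ H k m} = Real.exp (-(M.σ ^ 2 * M.τ / M.α)) := by
  have hα := M.α_pos
  have hσ := M.σ_pos
  have hs : 0 ≤ M.σ ^ 2 * M.τ / M.α :=
    div_nonneg (mul_nonneg (sq_nonneg _) M.τ_nonneg) hα.le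
  have hiff (x : ℝ) (hx : 0 ≤ x) : M.τ ≤ M.α * x ^ 2 / M.σ ^ 2 ↔ √(M.σ ^ 2 * M.τ / M.α) ≤ x := by
    rw [Real.sqrt_le_left hx, le_div_iff₀ (by positivity), div_le_iff₀ hα, mul_comm M.τ,
      mul_comm M.α]
  have hae : {H | M.τ ≤ S.sinr ℒ H k m} =ᵐ[M.channelLaw]
      (fun H => M.gain (S.u ℒ H k m) (H k k) (S.v ℒ H k m)) ⁻¹'
        {z | √(M.σ ^ 2 * M.τ / M.α) ≤ ‖z‖} := by
    filter_upwards [S.sinr_ae_eq hk m] with H hH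
    refine propext (?_ : M.τ ≤ S.sinr ℒ H k m ↔ _)
    rw [hH]
    exact hiff _ (norm_nonneg _)
  rw [measureReal_congr hae, ← map_measureReal_apply (S.measurable_gain ℒ k k m m)
    (measurableSet_le measurable_const measurable_norm), S.map_gain_direct hk m,
    complexGaussian_real_norm_ge (Real.sqrt_nonneg _), Real.sq_sqrt hs]

end IAScheme

/-- The mean service vector `μ(|ℒ|) 1_ℒ` of the active set `ℒ`. -/
def meanRate (M : SymmetricSystem) (ℒ : Finset (Fin M.N)) (k : Fin M.N) : ℝ :=
  if k ∈ ℒ then M.μ ℒ.card else 0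

lemma card_mul_θ_lt_one (ℒ : Finset (Fin M.N)) : ℒ.card * M.θ < 1 := by
  have hcard : (ℒ.card : ℝ) ≤ M.N := by
    exact_mod_cast (Finset.card_le_univ ℒ).trans_eq (Fintype.card_fin _)
  exact (mul_le_mul_of_nonneg_right hcard M.θ_pos.le).trans_lt M.Nθ_lt_one

namespace IAScheme

variable (S : M.IAScheme) (ℒ : Finset (Fin M.N)) (k : Fin M.N)

open Classical in
lemma measurable_service : Measurable fun H => S.service ℒ H k := by
  unfold service
  split_ifs
  · exact (Finset.measurable_sum _ fun m _ => Measurable.ite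
      (measurableSet_le measurable_const (S.measurable_sinr ℒ k m))
      measurable_const measurable_const).const_mul _
  · exact measurable_const

lemma service_mem_Icc (H : M.Channel) : S.service ℒ H k ∈ Set.Icc 0 (M.d * M.R) := by
  classical
  have hR := M.R_pos
  have hstream (m : Fin M.d) : (if M.τ ≤ S.sinr ℒ H k m then M.R else 0) ∈ Set.Icc 0 M.R := by
    split_ifs <;> simp [hR.le]
  have hsum_nonneg : 0 ≤ ∑ m : Fin M.d, if M.τ ≤ S.sinr ℒ H k m then M.R else 0 :=
    Finset.sum_nonneg fun m _ => (hstream m).1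
  have hsum_le : ∑ m : Fin M.d, (if M.τ ≤ S.sinr ℒ H k m then M.R else 0) ≤ M.d * M.R :=
    (Finset.sum_le_card_nsmul _ _ M.R fun m _ => (hstream m).2).trans_eq (by simp)
  have hfraction_nonneg : 0 ≤ 1 - ℒ.card * M.θ := sub_nonneg.2 (card_mul_θ_lt_one ℒ).le
  have hfraction_le : 1 - ℒ.card * M.θ ≤ 1 :=
    sub_le_self _ (mul_nonneg (Nat.cast_nonneg _) M.θ_pos.le)
  unfold service
  split_ifs
  · exact ⟨mul_nonneg hfraction_nonneg hsum_nonneg,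
      (mul_le_of_le_one_left hsum_nonneg hfraction_le).trans hsum_le⟩
  · exact ⟨le_rfl, by positivity⟩

lemma integral_service : ∫ H, S.service ℒ H k ∂M.channelLaw = M.meanRate ℒ k := by
  classical
  by_cases hk : k ∈ ℒ
  · have hmeas (m : Fin M.d) : MeasurableSet {H | M.τ ≤ S.sinr ℒ H k m} :=
      measurableSet_le measurable_const (S.measurable_sinr ℒ k m)
    have hstream (m : Fin M.d) : (fun H => if M.τ ≤ S.sinr ℒ H k m then M.R else 0)
        = {H | M.τ ≤ S.sinr ℒ H k m}.indicator fun _ => M.R := by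
      ext H; simp [Set.indicator_apply]
    have hintegrable (m : Fin M.d) : Integrable
        (fun H => if M.τ ≤ S.sinr ℒ H k m then M.R else 0) M.channelLaw := by
      rw [hstream]; exact (integrable_const _).indicator (hmeas m)
    simp only [service, meanRate, if_pos hk]
    rw [integral_const_mul, integral_finsetSum _ fun m _ => hintegrable m]
    simp only [hstream, integral_indicator_const _ (hmeas _), S.channelLaw_real_le_sinr hk, μ,
      Finset.sum_const, Finset.card_univ, Fintype.card_fin, nsmul_eq_mul, smul_eq_mul]
    ring
  · simp [service, meanRate, hk]

end IAScheme

end SymmetricSystem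

/-! ### The region `Λ_P` -/

section Convex

variable {ι : Type*}

/-- The uniform probability distribution on a finite set `t` (the zero vector when `t = ∅`). Rates
of active sets are multiples of it, which makes sets of different sizes comparable. -/
def uniformWeight (t : Finset ι) : ι → ℝ := (t.card : ℝ)⁻¹ • (t : Set ι).indicator 1

lemma sum_indicator_erase [DecidableEq ι] (t : Finset ι) :
    ∑ k ∈ t, (t.erase k : Set ι).indicator (1 : ι → ℝ)
      = ((t.card : ℝ) - 1) • (t : Set ι).indicator 1 := by
  ext j
  have hterm : ∀ k, (t.erase k : Set ι).indicator (1 : ι → ℝ) j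
      = (t : Set ι).indicator 1 j - if j = k then (t : Set ι).indicator 1 j else 0 := by
    intro k
    by_cases hj : j ∈ t <;> by_cases hjk : j = k <;> simp [Set.indicator_apply, hj, hjk]
  simp only [Finset.sum_apply, hterm, Finset.sum_sub_distrib, Finset.sum_const,
    Finset.sum_ite_eq, nsmul_eq_mul, Pi.smul_apply, smul_eq_mul]
  by_cases hj : j ∈ t <;> simp [hj]

lemma uniformWeight_eq_sum_erase [DecidableEq ι] {t : Finset ι} (ht : 2 ≤ t.card) :
    uniformWeight t = ∑ k ∈ t, (t.card : ℝ)⁻¹ • uniformWeight (t.erase k) := by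
  have hcard : ∀ k ∈ t, ((t.erase k).card : ℝ) = t.card - 1 := fun k hk => by
    rw [Finset.card_erase_of_mem hk, Nat.cast_pred (by lia)]
  have hpos : (0 : ℝ) < t.card - 1 := by
    have : (2 : ℝ) ≤ t.card := mod_cast ht
    linarith
  calc uniformWeight t
      = (t.card : ℝ)⁻¹ • ((t.card : ℝ) - 1)⁻¹ • ((t.card : ℝ) - 1) •
          (t : Set ι).indicator 1 := by
        rw [inv_smul_smul₀ hpos.ne', uniformWeight]
    _ = ∑ k ∈ t, (t.card : ℝ)⁻¹ • uniformWeight (t.erase k) := by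
        rw [← sum_indicator_erase, Finset.smul_sum, Finset.smul_sum]
        refine Finset.sum_congr rfl fun k hk => ?_
        rw [uniformWeight, hcard k hk]

lemma uniformWeight_mem_of_forall_card_eq {C : Set (ι → ℝ)} (hC : Convex ℝ C) {l : ℕ} (hl : 0 < l)
    (h : ∀ t : Finset ι, t.card = l → uniformWeight t ∈ C) {t : Finset ι} (ht : l ≤ t.card) :
    uniformWeight t ∈ C := by
  classical
  induction hn : t.card - l generalizing t with
  | zero => exact h t (by lia)
  | succ n ih =>
    rw [uniformWeight_eq_sum_erase (by lia)]
    refine hC.sum_mem (fun _ _ => by positivity) ?_ fun k hk => ?_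
    · rw [Finset.sum_const, nsmul_eq_mul, mul_inv_cancel₀ (Nat.cast_ne_zero.2 (by lia))]
    · have := Finset.card_erase_of_mem hk
      exact ih (by lia) (by lia)

lemma smul_mem_of_convex_of_le {E : Type*} [AddCommGroup E] [Module ℝ E] {C : Set E}
    (hC : Convex ℝ C) (h0 : 0 ∈ C) {x : E} {a b : ℝ} (hx : a • x ∈ C) (hb : 0 ≤ b) (hba : b ≤ a) :
    b • x ∈ C := by
  rcases (hb.trans hba).eq_or_lt with rfl | ha
  · rwa [le_antisymm hba hb]
  · have := hC.smul_mem_of_zero_mem h0 hx ⟨div_nonneg hb ha.le, div_le_one_of_le₀ hba ha.le⟩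
    rwa [smul_smul, div_mul_cancel₀ _ ha.ne'] at this

lemma update_mem_of_convex [DecidableEq ι] {C : Set (ι → ℝ)} (hC : Convex ℝ C) {x : ι → ℝ} {k : ι}
    (hx : x ∈ C) (hx0 : Function.update x k 0 ∈ C) {y : ℝ} (hy : 0 ≤ y) (hyx : y ≤ x k) :
    Function.update x k y ∈ C := by
  rcases (hy.trans hyx).eq_or_lt with h0 | h0
  · rwa [le_antisymm (hyx.trans h0.ge) hy]
  · have hmix := hC hx hx0 (a := y / x k) (b := 1 - y / x k) (div_nonneg hy h0.le)
      (sub_nonneg.2 (div_le_one_of_le₀ hyx h0.le)) (by ring)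
    convert hmix using 1
    ext j
    rcases eq_or_ne j k with rfl | hj
    · simp [h0.ne']
    · simp [hj, ← add_mul]

lemma mem_of_convex_of_le [Finite ι] [DecidableEq ι] {C : Set (ι → ℝ)} (hC : Convex ℝ C)
    (hC0 : ∀ x ∈ C, ∀ k, Function.update x k 0 ∈ C) {x y : ι → ℝ} (hx : x ∈ C) (hy : 0 ≤ y)
    (hyx : y ≤ x) : y ∈ C := by
  cases nonempty_fintype ι
  have hpiecewise : ∀ s : Finset ι, s.piecewise y x ∈ C := by
    intro s
    induction s using Finset.induction_on with
    | empty => simpa using hx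
    | insert k s hk ih =>
      rw [Finset.piecewise_insert]
      refine update_mem_of_convex hC ih (hC0 _ ih k) (hy k) ?_
      rw [Finset.piecewise_eq_of_notMem _ _ _ hk]
      exact hyx k
  simpa using hpiecewise Finset.univ

end Convex

namespace SymmetricSystem

variable (M : SymmetricSystem)

lemma μ_eq (L : ℕ) :
    M.μ L = (1 - L * M.θ) * (M.d * M.R * Real.exp (-(M.σ ^ 2 * M.τ / M.α))) := by
  rw [μ]; ring

lemma fullRate_pos : 0 < M.d * M.R * Real.exp (-(M.σ ^ 2 * M.τ / M.α)) :=
  mul_pos (mul_pos (Nat.cast_pos.2 M.d_pos) M.R_pos) (Real.exp_pos _)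

lemma μ_card_pos (ℒ : Finset (Fin M.N)) : 0 < M.μ ℒ.card := by
  rw [μ_eq]
  exact mul_pos (sub_pos.2 (M.card_mul_θ_lt_one ℒ)) M.fullRate_pos

lemma μ_antitone : Antitone M.μ := fun L L' h => by
  rw [μ_eq, μ_eq]
  have := M.θ_pos.le
  have := M.fullRate_pos.le
  gcongr

lemma μT_sub_μT (L L' : ℕ) : M.μT L - M.μT L' = ((L : ℝ) - L') * (1 - (L + L') * M.θ)
    * (M.d * M.R * Real.exp (-(M.σ ^ 2 * M.τ / M.α))) := by
  rw [μT, μT, μ_eq, μ_eq]; ring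

lemma μT_monotoneOn : MonotoneOn M.μT {L : ℕ | (L : ℝ) ≤ 1 / (2 * M.θ)} := by
  intro L hL L' hL' h
  have hθ : 1 / (2 * M.θ) * M.θ = 1 / 2 := by have := M.θ_pos; field_simp
  have hsum := mul_le_mul_of_nonneg_right (add_le_add hL' hL) M.θ_pos.le
  rw [add_mul (1 / (2 * M.θ)), hθ] at hsum
  rw [← sub_nonneg, μT_sub_μT]
  exact mul_nonneg (mul_nonneg (sub_nonneg.2 (mod_cast h)) (by linarith)) M.fullRate_pos.le

lemma μT_antitoneOn : AntitoneOn M.μT {L : ℕ | 1 / (2 * M.θ) ≤ L} := by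
  intro L hL L' hL' h
  have hθ : 1 / (2 * M.θ) * M.θ = 1 / 2 := by have := M.θ_pos; field_simp
  have hsum := mul_le_mul_of_nonneg_right (add_le_add hL hL') M.θ_pos.le
  rw [add_mul (1 / (2 * M.θ)), hθ] at hsum
  rw [← sub_nonneg, μT_sub_μT]
  refine mul_nonneg (mul_nonneg_of_nonpos_of_nonpos ?_ (by linarith)) M.fullRate_pos.le
  exact sub_nonpos.2 (mod_cast h)

lemma μT_le_μT_LP (L : ℕ) : M.μT L ≤ M.μT M.LP := by
  have hx : 0 ≤ 1 / (2 * M.θ) := by have := M.θ_pos; positivity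
  have hmax : M.μT ⌊1 / (2 * M.θ)⌋₊ ≤ M.μT M.LP ∧ M.μT ⌈1 / (2 * M.θ)⌉₊ ≤ M.μT M.LP := by
    unfold LP
    split_ifs with h
    · exact ⟨h, le_rfl⟩
    · exact ⟨le_rfl, (not_le.1 h).le⟩
  rcases le_total (L : ℝ) (1 / (2 * M.θ)) with h | h
  · exact (M.μT_monotoneOn h (Nat.floor_le hx) (Nat.le_floor h)).trans hmax.1
  · exact (M.μT_antitoneOn (Nat.le_ceil (1 / (2 * M.θ))) h (Nat.ceil_le.2 h)).trans hmax.2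

variable {M} in
lemma meanRate_nonneg (ℒ : Finset (Fin M.N)) : 0 ≤ M.meanRate ℒ := fun k => by
  unfold meanRate
  split_ifs
  · exact (M.μ_card_pos ℒ).le
  · exact le_rfl

lemma meanRate_eq_smul_indicator (ℒ : Finset (Fin M.N)) :
    M.meanRate ℒ = M.μ ℒ.card • (ℒ : Set (Fin M.N)).indicator 1 := by
  ext k; simp [meanRate, Set.indicator_apply]

lemma meanRate_eq_smul_uniformWeight (ℒ : Finset (Fin M.N)) :
    M.meanRate ℒ = M.μT ℒ.card • uniformWeight ℒ := by
  rcases ℒ.eq_empty_or_nonempty with rfl | hℒ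
  · simp [meanRate_eq_smul_indicator, uniformWeight, ← Pi.zero_def]
  · have : (ℒ.card : ℝ) ≠ 0 := Nat.cast_ne_zero.2 hℒ.card_ne_zero
    rw [meanRate_eq_smul_indicator, uniformWeight, smul_smul, μT, mul_comm,
      inv_mul_cancel_left₀ this]

lemma meanRate_mem_rateVectors (ℒ : Finset (Fin M.N)) :
    M.meanRate ℒ ∈ M.rateVectors ℒ.card := by
  refine ⟨(ℒ : Set (Fin M.N)).indicator 1, ⟨fun k => ?_, ?_⟩, (M.meanRate_eq_smul_indicator ℒ).symm⟩
  · exact Set.indicator_eq_zero_or_self _ _ k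
  · simp [Set.indicator_apply, apply_ite abs]

variable {M} in
lemma exists_eq_meanRate_of_mem_rateVectors {L : ℕ} {x : Fin M.N → ℝ} (hx : x ∈ M.rateVectors L) :
    ∃ ℒ, x = M.meanRate ℒ := by
  classical
  obtain ⟨s, ⟨hs, hsum⟩, rfl⟩ := hx
  let ℒ := Finset.univ.filter fun k => s k = 1
  have hs_eq : s = (ℒ : Set (Fin M.N)).indicator 1 := by
    ext k
    rcases hs k with h | h <;> simp [ℒ, h]
  have hcard : ℒ.card = L := by
    have habs : ∀ k, |s k| = if s k = 1 then 1 else 0 := fun k => by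
      rcases hs k with h | h <;> simp [h]
    rw [Finset.sum_congr rfl fun k _ => habs k, Finset.sum_boole] at hsum
    exact_mod_cast hsum
  exact ⟨ℒ, by rw [meanRate_eq_smul_indicator, hcard, ← hs_eq]⟩

lemma convex_regionP : Convex ℝ M.regionP := convex_closedConvexHull

lemma isClosed_regionP : IsClosed M.regionP := isClosed_closedConvexHull

variable {M}

lemma regionP_subset {C : Set (Fin M.N → ℝ)} (hC : Convex ℝ C) (hC' : IsClosed C)
    (h : ∀ ℒ, M.meanRate ℒ ∈ C) : M.regionP ⊆ C := by
  refine closedConvexHull_min (Set.iUnion₂_subset fun L _ x hx => ?_) hC hC'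
  obtain ⟨ℒ, rfl⟩ := exists_eq_meanRate_of_mem_rateVectors hx
  exact h ℒ

lemma meanRate_mem_regionP_of_card_le {ℒ : Finset (Fin M.N)} (h : ℒ.card ≤ M.LP) :
    M.meanRate ℒ ∈ M.regionP :=
  subset_closedConvexHull (Set.mem_iUnion₂.2 ⟨_, h, M.meanRate_mem_rateVectors ℒ⟩)

variable (M) in
lemma zero_mem_regionP : (0 : Fin M.N → ℝ) ∈ M.regionP := by
  simpa [meanRate_eq_smul_indicator, ← Pi.zero_def] using
    meanRate_mem_regionP_of_card_le (M := M) (ℒ := ∅) (Nat.zero_le _)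

lemma meanRate_mem_regionP (ℒ : Finset (Fin M.N)) : M.meanRate ℒ ∈ M.regionP := by
  rcases le_or_gt ℒ.card M.LP with h | h
  · exact meanRate_mem_regionP_of_card_le h
  have hTpos : 0 < M.μT ℒ.card := mul_pos (Nat.cast_pos.2 (by lia)) (M.μ_card_pos ℒ)
  have hLP : M.LP ≠ 0 := fun h0 => by
    have hle := M.μT_le_μT_LP ℒ.card
    exact hTpos.not_ge (hle.trans_eq (by simp [h0, μT]))
  have hmix : uniformWeight ℒ ∈ (fun x => M.μT M.LP • x) ⁻¹' M.regionP :=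
    uniformWeight_mem_of_forall_card_eq (M.convex_regionP.smul_preimage _) (Nat.pos_of_ne_zero hLP)
      (fun t ht => by
        have := meanRate_mem_regionP_of_card_le ht.le
        rwa [meanRate_eq_smul_uniformWeight, ht] at this) h.le
  rw [meanRate_eq_smul_uniformWeight]
  exact smul_mem_of_convex_of_le M.convex_regionP M.zero_mem_regionP hmix hTpos.le
    (M.μT_le_μT_LP _)

lemma nonneg_of_mem_regionP {x : Fin M.N → ℝ} (hx : x ∈ M.regionP) : 0 ≤ x :=
  regionP_subset (convex_Ici 0) isClosed_Ici meanRate_nonneg hx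

lemma update_zero_mem_regionP {x : Fin M.N → ℝ} (hx : x ∈ M.regionP) (k : Fin M.N) :
    Function.update x k 0 ∈ M.regionP := by
  have hlin : IsLinearMap ℝ fun x : Fin M.N → ℝ => Function.update x k 0 :=
    ⟨fun x y => by simpa using Function.update_add x y k 0 0,
      fun c x => by simpa using Function.update_smul c x k (0 : ℝ)⟩
  refine regionP_subset (M.convex_regionP.is_linear_preimage hlin)
    (M.isClosed_regionP.preimage (by fun_prop)) (fun ℒ => ?_) hx
  have hupdate : Function.update (M.meanRate ℒ) k 0
      = M.μ ℒ.card • ((ℒ.erase k : Finset _) : Set (Fin M.N)).indicator 1 := by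
    ext j
    rcases eq_or_ne j k with rfl | hj <;> simp [meanRate, Set.indicator_apply, *]
  rw [Set.mem_preimage, hupdate]
  have herase := meanRate_mem_regionP (ℒ.erase k)
  rw [meanRate_eq_smul_indicator] at herase
  exact smul_mem_of_convex_of_le M.convex_regionP M.zero_mem_regionP herase (M.μ_card_pos ℒ).le
    (M.μ_antitone (Finset.card_le_card (Finset.erase_subset _ _)))

lemma mem_regionP_of_le {x y : Fin M.N → ℝ} (hx : x ∈ M.regionP) (hy : 0 ≤ y) (hyx : y ≤ x) :
    y ∈ M.regionP :=
  mem_of_convex_of_le M.convex_regionP (fun _ hz => update_zero_mem_regionP hz) hx hy hyx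

lemma regionP_mem_nhdsWithin_smul {a : Fin M.N → ℝ} (ha : a ∈ M.regionP) {δ : ℝ} (hδ : 0 < δ)
    (hδ1 : δ ≤ 1) : M.regionP ∈ 𝓝[{b | ∀ k, 0 ≤ b k}] ((1 - δ) • a) := by
  set x := (1 - δ) • a + δ • M.meanRate Finset.univ
  have hx : x ∈ M.regionP :=
    M.convex_regionP ha (meanRate_mem_regionP _) (sub_nonneg.2 hδ1) hδ.le (by ring)
  have hlt : ∀ k, ((1 - δ) • a) k < x k := fun k => by
    have : M.meanRate Finset.univ k = M.μ (Finset.univ : Finset (Fin M.N)).card := by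
      simp [meanRate]
    exact lt_add_of_pos_right _ (mul_pos hδ (this ▸ M.μ_card_pos _))
  have hnear : ∀ᶠ b in 𝓝 ((1 - δ) • a), ∀ k, b k < x k :=
    eventually_all.2 fun k => (continuous_apply k).continuousAt.eventually_lt_const (hlt k)
  filter_upwards [nhdsWithin_le_nhds hnear, self_mem_nhdsWithin] with b hbx hb0
  exact mem_regionP_of_le hx hb0 fun k => (hbx k).le

lemma exists_add_mem_regionP {a : Fin M.N → ℝ} (ha : ∀ k, 0 ≤ a k)
    (h : M.regionP ∈ 𝓝[{b | ∀ k, 0 ≤ b k}] a) :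
    ∃ ε > 0, (fun k => a k + ε) ∈ M.regionP := by
  have htendsto : Tendsto (fun (ε : ℝ) k => a k + ε) (𝓝[>] 0) (𝓝[{b | ∀ k, 0 ≤ b k}] a) := by
    refine tendsto_nhdsWithin_iff.2 ⟨?_, ?_⟩
    · exact ((by fun_prop : Continuous fun (ε : ℝ) k => a k + ε).tendsto' 0 a
        (by simp)).mono_left nhdsWithin_le_nhds
    · filter_upwards [self_mem_nhdsWithin] with ε hε k
      exact add_nonneg (ha k) (le_of_lt hε)
  obtain ⟨ε, hε, hε0⟩ := ((htendsto.eventually h).and self_mem_nhdsWithin).exists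
  exact ⟨ε, hε0, hε⟩

end SymmetricSystem

/-! ### Real sequences -/

lemma add_sum_range_le_of_forall_succ {V W : ℕ → ℝ} {D : ℝ}
    (h : ∀ t, V (t + 1) + W t ≤ V t + D) (T : ℕ) :
    V T + ∑ t ∈ Finset.range T, W t ≤ V 0 + T * D := by
  induction T with
  | zero => simp
  | succ T ih =>
    rw [Finset.sum_range_succ]
    push_cast
    linarith [h T]

lemma exists_le_mul_of_eventually_sum_range_le {w : ℕ → ℝ} (hw : 0 ≤ w 0) {C : ℝ}
    (h : ∀ᶠ T : ℕ in atTop, ∑ t ∈ Finset.range T, w t ≤ C * T) {ε : ℝ} (hε : 0 < ε) :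
    ∃ T : ℕ, 0 < T ∧ w T ≤ ε * T := by
  by_contra! hcon
  have hsum : ∀ T : ℕ, ε * (T * (T - 1) / 2) ≤ ∑ t ∈ Finset.range T, w t := by
    intro T
    induction T with
    | zero => simp
    | succ T ih =>
      have hT : ε * T ≤ w T := by
        rcases T.eq_zero_or_pos with rfl | hT
        · simpa using hw
        · exact (hcon T hT).le
      rw [Finset.sum_range_succ]
      push_cast
      linarith
  have hlarge : ∀ᶠ T : ℕ in atTop, 2 * C / ε + 1 < T :=
    tendsto_natCast_atTop_atTop.eventually_gt_atTop _
  obtain ⟨T, hT, hTC, hT0⟩ := (h.and (hlarge.and (eventually_gt_atTop 0))).exists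
  have hCε : 2 * C < ε * (T - 1) := (div_lt_iff₀' hε).1 (by linarith)
  have hT0 : (0 : ℝ) < T := Nat.cast_pos.2 hT0
  linarith [(hsum T).trans hT, mul_lt_mul_of_pos_right hCε hT0]

lemma limsup_sum_ofReal_div_lt_top_iff {w : ℕ → ℝ} (hw : ∀ t, 0 ≤ w t) :
    limsup (fun T : ℕ => (∑ t ∈ Finset.range T, ENNReal.ofReal (w t)) / (T : ENNReal)) atTop < ⊤ ↔
      ∃ C : ℝ, ∀ᶠ T : ℕ in atTop, ∑ t ∈ Finset.range T, w t ≤ C * T := by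
  have haverage : ∀ T : ℕ, 0 < T →
      (∑ t ∈ Finset.range T, ENNReal.ofReal (w t)) / (T : ENNReal)
        = ENNReal.ofReal ((∑ t ∈ Finset.range T, w t) / T) := fun T hT => by
    rw [← ENNReal.ofReal_sum_of_nonneg fun t _ => hw t,
      ENNReal.ofReal_div_of_pos (Nat.cast_pos.2 hT), ENNReal.ofReal_natCast]
  constructor
  · intro h
    obtain ⟨C, hC, -⟩ := ENNReal.lt_iff_exists_nnreal_btwn.1 h
    refine ⟨C, ?_⟩
    filter_upwards [eventually_lt_of_limsup_lt hC, eventually_gt_atTop 0] with T hT hT0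
    rw [haverage T hT0] at hT
    have hle := (ENNReal.ofReal_lt_coe_iff (div_nonneg (Finset.sum_nonneg fun t _ => hw t)
      (Nat.cast_nonneg _))).1 hT
    exact ((div_lt_iff₀ (Nat.cast_pos.2 hT0)).1 hle).le
  · rintro ⟨C, hC⟩
    refine (limsup_le_of_le (by isBoundedDefault) ?_).trans_lt (ENNReal.ofReal_lt_top (r := C))
    filter_upwards [hC, eventually_gt_atTop 0] with T hT hT0
    rw [haverage T hT0]
    exact ENNReal.ofReal_le_ofReal ((div_le_iff₀ (Nat.cast_pos.2 hT0)).2 hT)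

/-! ### Queue dynamics -/

lemma sq_max_sub_zero_add_le {q B a : ℝ} (hq : 0 ≤ q) (hB : 0 ≤ B) (ha : 0 ≤ a) :
    (max (q - B) 0 + a) ^ 2 ≤ q ^ 2 + B ^ 2 + a ^ 2 + 2 * (q * a) - 2 * (q * B) := by
  have hsq : max (q - B) 0 ^ 2 ≤ (q - B) ^ 2 :=
    sq_le_sq.2 ((abs_of_nonneg (le_max_right _ _)).trans_le
      (max_le (le_abs_self _) (abs_nonneg _)))
  have hcross : max (q - B) 0 * a ≤ q * a :=
    mul_le_mul_of_nonneg_right (max_le (sub_le_self q hB) hq) ha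
  linarith [add_sq (max (q - B) 0) a, sub_sq q B]

namespace ArrivalLaw

variable {N : ℕ}

lemma mean_nonneg (A : ArrivalLaw N) : 0 ≤ A.mean := fun k => by
  obtain ⟨C, hC⟩ := A.bounded
  exact integral_nonneg_of_ae ((hC k).mono fun x hx => hx.1)

/-- The deterministic arrivals `a`, which witness that every nonnegative vector is the mean of some
arrival law. -/
def dirac (a : Fin N → ℝ) (ha : ∀ k, 0 ≤ a k) : ArrivalLaw N where
  law k := Measure.dirac (a k)
  prob _ := inferInstance
  bounded := ⟨∑ k, a k + 1, fun k => by
    have hlt : a k < ∑ k, a k + 1 :=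
      (Finset.single_le_sum (fun k _ => ha k) (Finset.mem_univ k)).trans_lt (lt_add_one _)
    exact (ae_dirac_iff (measurableSet_Ici.inter measurableSet_Iio)).2 ⟨ha k, hlt⟩⟩

lemma mean_dirac (a : Fin N → ℝ) (ha : ∀ k, 0 ≤ a k) : (dirac a ha).mean = a := by
  ext k; simp [mean, dirac]

end ArrivalLaw

namespace SymmetricSystem

variable {M : SymmetricSystem}

lemma meanRate_mem_Icc (ℒ : Finset (Fin M.N)) (k : Fin M.N) :
    M.meanRate ℒ k ∈ Set.Icc 0 (M.μ 0) := by
  refine ⟨meanRate_nonneg ℒ k, ?_⟩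
  unfold meanRate
  split_ifs
  · exact M.μ_antitone (Nat.zero_le _)
  · exact (M.μ_card_pos ∅).le

section Arrivals

variable (A : ArrivalLaw M.N)

instance : IsProbabilityMeasure (pathLaw A) := by
  unfold pathLaw; infer_instance

lemma measurePreserving_arrival (k : Fin M.N) :
    MeasurePreserving (fun x : M.Slot => x.1 k) (slotLaw A) (A.law k) :=
  (measurePreserving_eval A.law k).comp
    (measurePreserving_fst (ν := M.channelLaw.prod (volume : Measure unitInterval)))

lemma integral_arrival (k : Fin M.N) : ∫ x : M.Slot, x.1 k ∂slotLaw A = A.mean k := by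
  rw [ArrivalLaw.mean, ← (measurePreserving_arrival A k).map_eq,
    integral_map (by fun_prop) (by fun_prop)]

lemma exists_ae_arrival_mem_Icc :
    ∃ C : ℝ, ∀ᵐ ω ∂pathLaw (M := M) A, ∀ t k, (ω t).1 k ∈ Set.Icc 0 C := by
  obtain ⟨C, hC⟩ := A.bounded
  refine ⟨C, ae_all_iff.2 fun t => ae_all_iff.2 fun k => ?_⟩
  have hcoord : MeasurePreserving (fun ω : ℕ → M.Slot => (ω t).1 k) (pathLaw A) (A.law k) :=
    (measurePreserving_arrival A k).comp (measurePreserving_eval_infinitePi _ t)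
  filter_upwards [hcoord.quasiMeasurePreserving.ae (hC k)] with ω hω using ⟨hω.1, hω.2.le⟩

lemma integral_update_slot (t : ℕ) {f : (ℕ → M.Slot) → ℝ} (hf : Integrable f (pathLaw A)) :
    ∫ ω, f ω ∂pathLaw A = ∫ ω, ∫ x, f (Function.update ω t x) ∂slotLaw A ∂pathLaw A :=
  integral_resample (measurePreserving_update_infinitePi (fun _ => slotLaw A) t) hf

lemma integrable_mul_arrival (t : ℕ) (k : Fin M.N) {g : (ℕ → M.Slot) → ℝ}
    (hg : Integrable g (pathLaw A)) : Integrable (fun ω => g ω * (ω t).1 k) (pathLaw A) := by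
  obtain ⟨C, hC⟩ := exists_ae_arrival_mem_Icc (M := M) A
  refine hg.mul_bdd (c := C) (Measurable.aestronglyMeasurable (by fun_prop)) ?_
  filter_upwards [hC] with ω hω
  rw [Real.norm_of_nonneg (hω t k).1]
  exact (hω t k).2

lemma integral_mul_arrival (t : ℕ) (k : Fin M.N) {g : (ℕ → M.Slot) → ℝ}
    (hg : Integrable g (pathLaw A)) (hgt : ∀ ω x, g (Function.update ω t x) = g ω) :
    ∫ ω, g ω * (ω t).1 k ∂pathLaw A = (∫ ω, g ω ∂pathLaw A) * A.mean k := by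
  rw [integral_update_slot A t (integrable_mul_arrival A t k hg)]
  simp only [hgt, Function.update_self, integral_const_mul, integral_arrival, integral_mul_const]

end Arrivals

namespace IAScheme

variable (S : M.IAScheme)

lemma measurable_service_uncurry (k : Fin M.N) :
    Measurable fun p : Finset (Fin M.N) × M.Channel => S.service p.1 p.2 k :=
  measurable_from_prod_countable_right fun ℒ => S.measurable_service ℒ k

lemma integral_service_of_measurable (A : ArrivalLaw M.N) (k : Fin M.N)
    {f : unitInterval → Finset (Fin M.N)} (hf : Measurable f) :
    ∫ x, S.service (f x.2.2) x.2.1 k ∂slotLaw A = ∫ x, M.meanRate (f x.2.2) k ∂slotLaw A := by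
  have hservice : Integrable (fun y : M.Channel × unitInterval => S.service (f y.2) y.1 k)
      (M.channelLaw.prod volume) :=
    Integrable.of_mem_Icc 0 (M.d * M.R) ((S.measurable_service_uncurry k).comp
      ((hf.comp measurable_snd).prodMk measurable_fst)).aemeasurable
      (ae_of_all _ fun y => S.service_mem_Icc _ _ _)
  rw [slotLaw, integral_fun_snd (fun y : M.Channel × unitInterval => S.service (f y.2) y.1 k),
    integral_fun_snd (fun y : M.Channel × unitInterval => M.meanRate (f y.2) k),
    integral_fun_snd (fun s => M.meanRate (f s) k), integral_prod_symm _ hservice]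
  simp only [S.integral_service, probReal_univ, one_smul]

variable (π : Policy M.N) (q₀ : Fin M.N → ℝ)

/-- The set of pairs that the policy activates in slot `t`. -/
def active (ω : ℕ → M.Slot) (t : ℕ) : Finset (Fin M.N) :=
  π.select t (S.history π q₀ ω t) (ω t).2.2

/-- The number `B_k(t)` of bits offered to user `k` in slot `t` under the policy. -/
def offered (ω : ℕ → M.Slot) (t : ℕ) (k : Fin M.N) : ℝ :=
  S.service (S.active π q₀ ω t) (ω t).2.1 k

lemma queue_succ (ω : ℕ → M.Slot) (t : ℕ) (k : Fin M.N) :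
    S.queue π q₀ ω (t + 1) k
      = max (S.queue π q₀ ω t k - S.offered π q₀ ω t k) 0 + (ω t).1 k := by
  simp [queue, history, active, offered]

lemma history_congr {ω ω' : ℕ → M.Slot} {t : ℕ} (h : ∀ i < t, ω i = ω' i) :
    S.history π q₀ ω t = S.history π q₀ ω' t := by
  induction t with
  | zero => rfl
  | succ t ih =>
    simp only [history, ih fun i hi => h i (hi.trans t.lt_succ_self), h t t.lt_succ_self]

lemma history_update (ω : ℕ → M.Slot) (t : ℕ) (x : M.Slot) :
    S.history π q₀ (Function.update ω t x) t = S.history π q₀ ω t :=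
  S.history_congr π q₀ fun _ hi => Function.update_of_ne hi.ne _ _

lemma queue_update (ω : ℕ → M.Slot) (t : ℕ) (x : M.Slot) :
    S.queue π q₀ (Function.update ω t x) t = S.queue π q₀ ω t :=
  congrFun (S.history_update π q₀ ω t x) _

section Measurability

variable {S π q₀} {t : ℕ}

lemma measurable_active_of_history (h : Measurable fun ω => S.history π q₀ ω t) :
    Measurable fun ω => S.active π q₀ ω t :=
  (π.measurable_select t).comp (h.prodMk (by fun_prop))

lemma measurable_offered_of_history (h : Measurable fun ω => S.history π q₀ ω t) (k : Fin M.N) :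
    Measurable fun ω => S.offered π q₀ ω t k :=
  (S.measurable_service_uncurry k).comp ((measurable_active_of_history h).prodMk (by fun_prop))

end Measurability

lemma measurable_history (t : ℕ) : Measurable fun ω => S.history π q₀ ω t := by
  induction t with
  | zero => exact measurable_const
  | succ t ih =>
    refine measurable_pi_iff.2 fun i => ?_
    induction i using Fin.lastCases with
    | cast i =>
      simp only [history, Fin.snoc_castSucc]
      exact (measurable_pi_apply i).comp ih
    | last =>
      change Measurable fun ω => S.queue π q₀ ω (t + 1)
      refine measurable_pi_iff.2 fun k => ?_
      simp only [queue_succ]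
      have hqueue : Measurable fun ω => S.queue π q₀ ω t k := by
        unfold queue; fun_prop
      have hoffered := measurable_offered_of_history ih k
      fun_prop

lemma measurable_queue (t : ℕ) (k : Fin M.N) : Measurable fun ω => S.queue π q₀ ω t k := by
  have := S.measurable_history π q₀ t
  unfold queue
  fun_prop

lemma measurable_meanRate_active (t : ℕ) (k : Fin M.N) :
    Measurable fun ω => M.meanRate (S.active π q₀ ω t) k :=
  (measurable_of_countable fun ℒ => M.meanRate ℒ k).comp
    (measurable_active_of_history (S.measurable_history π q₀ t))

section Expectation

variable (A : ArrivalLaw M.N) (t : ℕ) (k : Fin M.N) {g : (ℕ → M.Slot) → ℝ}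

lemma integrable_mul_offered (hg : Integrable g (pathLaw A)) :
    Integrable (fun ω => g ω * S.offered π q₀ ω t k) (pathLaw A) := by
  refine hg.mul_bdd (c := M.d * M.R) (measurable_offered_of_history
    (S.measurable_history π q₀ t) k).aestronglyMeasurable (ae_of_all _ fun ω => ?_)
  have h := S.service_mem_Icc (S.active π q₀ ω t) k (ω t).2.1
  exact (Real.norm_of_nonneg h.1).trans_le h.2

lemma integrable_mul_meanRate_active (hg : Integrable g (pathLaw A)) :
    Integrable (fun ω => g ω * M.meanRate (S.active π q₀ ω t) k) (pathLaw A) := by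
  refine hg.mul_bdd (c := M.μ 0) (S.measurable_meanRate_active π q₀ t k).aestronglyMeasurable
    (ae_of_all _ fun ω => ?_)
  have h := meanRate_mem_Icc (S.active π q₀ ω t) k
  exact (Real.norm_of_nonneg h.1).trans_le h.2

lemma integral_mul_offered (hg : Integrable g (pathLaw A))
    (hgt : ∀ ω x, g (Function.update ω t x) = g ω) :
    ∫ ω, g ω * S.offered π q₀ ω t k ∂pathLaw A
      = ∫ ω, g ω * M.meanRate (S.active π q₀ ω t) k ∂pathLaw A := by
  rw [integral_update_slot A t (S.integrable_mul_offered π q₀ A t k hg),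
    integral_update_slot A t (S.integrable_mul_meanRate_active π q₀ A t k hg)]
  refine integral_congr_ae (ae_of_all _ fun ω => ?_)
  have hselect : Measurable fun s => π.select t (S.history π q₀ ω t) s :=
    (π.measurable_select t).comp measurable_prodMk_left
  simp only [hgt, offered, active, history_update, Function.update_self, integral_const_mul,
    S.integral_service_of_measurable A k hselect]

end Expectation

end IAScheme

namespace IAScheme

variable (S : M.IAScheme) (π : Policy M.N) {q₀ : Fin M.N → ℝ}

lemma queue_mem_Icc (hq₀ : ∀ k, 0 ≤ q₀ k) {ω : ℕ → M.Slot} {C : ℝ}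
    (hω : ∀ t k, (ω t).1 k ∈ Set.Icc 0 C) (t : ℕ) (k : Fin M.N) :
    S.queue π q₀ ω t k ∈ Set.Icc 0 (q₀ k + t * C) := by
  induction t with
  | zero => simpa [queue, history] using hq₀ k
  | succ t ih =>
    rw [queue_succ]
    have hB : 0 ≤ S.offered π q₀ ω t k := (S.service_mem_Icc _ _ _).1
    have hmax : max (S.queue π q₀ ω t k - S.offered π q₀ ω t k) 0 ≤ S.queue π q₀ ω t k :=
      max_le (sub_le_self _ hB) ih.1
    refine ⟨add_nonneg (le_max_right _ _) (hω t k).1, ?_⟩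
    push_cast
    linarith [ih.2, (hω t k).2]

lemma ae_queue_nonneg (hq₀ : ∀ k, 0 ≤ q₀ k) (A : ArrivalLaw M.N) (t : ℕ) (k : Fin M.N) :
    ∀ᵐ ω ∂pathLaw A, 0 ≤ S.queue π q₀ ω t k := by
  obtain ⟨C, hC⟩ := exists_ae_arrival_mem_Icc A
  filter_upwards [hC] with ω hω using (S.queue_mem_Icc π hq₀ hω t k).1

lemma integrable_queue_pow (hq₀ : ∀ k, 0 ≤ q₀ k) (A : ArrivalLaw M.N) (t : ℕ) (k : Fin M.N)
    (n : ℕ) : Integrable (fun ω => S.queue π q₀ ω t k ^ n) (pathLaw A) := by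
  obtain ⟨C, hC⟩ := exists_ae_arrival_mem_Icc A
  refine Integrable.of_mem_Icc 0 ((q₀ k + t * C) ^ n)
    ((S.measurable_queue π q₀ t k).pow_const n).aemeasurable ?_
  filter_upwards [hC] with ω hω
  have h := S.queue_mem_Icc π hq₀ hω t k
  exact ⟨pow_nonneg h.1 n, pow_le_pow_left₀ h.1 h.2 n⟩

lemma integrable_queue (hq₀ : ∀ k, 0 ≤ q₀ k) (A : ArrivalLaw M.N) (t : ℕ) (k : Fin M.N) :
    Integrable (fun ω => S.queue π q₀ ω t k) (pathLaw A) := by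
  simpa using S.integrable_queue_pow π hq₀ A t k 1

variable (q₀) in
/-- The expected queue length `𝔼 q_k(t)`, as a real number. -/
def expectedQueue (A : ArrivalLaw M.N) (t : ℕ) (k : Fin M.N) : ℝ :=
  ∫ ω, S.queue π q₀ ω t k ∂pathLaw A

variable (q₀) in
/-- The mean service vector of the active set of slot `t`, averaged over the sample paths. -/
def expectedRate (A : ArrivalLaw M.N) (t : ℕ) : Fin M.N → ℝ :=
  ∫ ω, M.meanRate (S.active π q₀ ω t) ∂pathLaw A

lemma expectedQueue_nonneg (hq₀ : ∀ k, 0 ≤ q₀ k) (A : ArrivalLaw M.N) (t : ℕ) (k : Fin M.N) :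
    0 ≤ S.expectedQueue π q₀ A t k :=
  integral_nonneg_of_ae (S.ae_queue_nonneg π hq₀ A t k)

lemma stronglyStable_iff (hq₀ : ∀ k, 0 ≤ q₀ k) (A : ArrivalLaw M.N) :
    S.StronglyStable A q₀ π ↔ ∀ k, ∃ C : ℝ, ∀ᶠ T : ℕ in atTop,
      ∑ t ∈ Finset.range T, S.expectedQueue π q₀ A t k ≤ C * T := by
  refine forall_congr' fun k => ?_
  rw [← limsup_sum_ofReal_div_lt_top_iff fun t => S.expectedQueue_nonneg π hq₀ A t k]
  simp only [expectedQueue, ofReal_integral_eq_lintegral_ofReal (S.integrable_queue π hq₀ A _ k)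
    (S.ae_queue_nonneg π hq₀ A _ k)]

/-! ### Necessity -/

lemma integrable_meanRate_active (A : ArrivalLaw M.N) (t : ℕ) (k : Fin M.N) :
    Integrable (fun ω => M.meanRate (S.active π q₀ ω t) k) (pathLaw A) := by
  simpa using S.integrable_mul_meanRate_active π q₀ A t k (integrable_const 1)

lemma expectedRate_apply (A : ArrivalLaw M.N) (t : ℕ) (k : Fin M.N) :
    S.expectedRate π q₀ A t k = ∫ ω, M.meanRate (S.active π q₀ ω t) k ∂pathLaw A :=
  eval_integral (fun k => S.integrable_meanRate_active (q₀ := q₀) π A t k) k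

lemma expectedRate_mem_regionP (A : ArrivalLaw M.N) (t : ℕ) :
    S.expectedRate π q₀ A t ∈ M.regionP :=
  M.convex_regionP.integral_mem M.isClosed_regionP (ae_of_all _ fun _ => meanRate_mem_regionP _)
    (Integrable.of_eval fun k => S.integrable_meanRate_active π A t k)

lemma expectedQueue_add_mean_sub_le (hq₀ : ∀ k, 0 ≤ q₀ k) (A : ArrivalLaw M.N) (t : ℕ)
    (k : Fin M.N) :
    S.expectedQueue π q₀ A t k + A.mean k - S.expectedRate π q₀ A t k
      ≤ S.expectedQueue π q₀ A (t + 1) k := by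
  have hqueue := S.integrable_queue π hq₀ A t k
  have harrival : Integrable (fun ω : ℕ → M.Slot => (ω t).1 k) (pathLaw A) := by
    simpa using integrable_mul_arrival A t k (integrable_const 1)
  have hsum : Integrable (fun ω => S.queue π q₀ ω t k + (ω t).1 k) (pathLaw A) :=
    hqueue.add harrival
  have hoffered : Integrable (fun ω => S.offered π q₀ ω t k) (pathLaw A) := by
    simpa using S.integrable_mul_offered π q₀ A t k (integrable_const 1)
  have hmean : ∫ ω, (ω t).1 k ∂pathLaw A = A.mean k := by
    simpa using integral_mul_arrival A t k (integrable_const 1) fun _ _ => rfl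
  have hrate : ∫ ω, S.offered π q₀ ω t k ∂pathLaw A = S.expectedRate π q₀ A t k := by
    simpa [expectedRate_apply] using
      S.integral_mul_offered π q₀ A t k (integrable_const 1) fun _ _ => rfl
  calc S.expectedQueue π q₀ A t k + A.mean k - S.expectedRate π q₀ A t k
      = ∫ ω, S.queue π q₀ ω t k + (ω t).1 k - S.offered π q₀ ω t k ∂pathLaw A := by
        rw [integral_sub hsum hoffered, integral_add hqueue harrival, hmean,
          hrate, expectedQueue]
    _ ≤ S.expectedQueue π q₀ A (t + 1) k := by
        refine integral_mono (hsum.sub hoffered)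
          (S.integrable_queue π hq₀ A (t + 1) k) fun ω => ?_
        simp only [queue_succ]
        linarith [le_max_left (S.queue π q₀ ω t k - S.offered π q₀ ω t k) 0]

lemma mul_mean_sub_sum_expectedRate_le (hq₀ : ∀ k, 0 ≤ q₀ k) (A : ArrivalLaw M.N) (T : ℕ)
    (k : Fin M.N) :
    T * A.mean k - ∑ t ∈ Finset.range T, S.expectedRate π q₀ A t k
      ≤ S.expectedQueue π q₀ A T k := by
  have htelescope := add_sum_range_le_of_forall_succ
    (V := fun t => -S.expectedQueue π q₀ A t k) (W := fun t => -S.expectedRate π q₀ A t k)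
    (D := -A.mean k) (fun t => by linarith [S.expectedQueue_add_mean_sub_le π hq₀ A t k]) T
  rw [Finset.sum_neg_distrib] at htelescope
  linarith [S.expectedQueue_nonneg π hq₀ A 0 k]

variable {π} in
lemma exists_forall_expectedQueue_le (hq₀ : ∀ k, 0 ≤ q₀ k) {A : ArrivalLaw M.N}
    (h : S.StronglyStable A q₀ π) {ε : ℝ} (hε : 0 < ε) :
    ∃ T : ℕ, 0 < T ∧ ∀ k, S.expectedQueue π q₀ A T k ≤ ε * T := by
  have hQ (t : ℕ) (k : Fin M.N) := S.expectedQueue_nonneg π hq₀ A t k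
  choose C hC using (S.stronglyStable_iff π hq₀ A).1 h
  have htotal : ∀ᶠ T : ℕ in atTop,
      ∑ t ∈ Finset.range T, ∑ k, S.expectedQueue π q₀ A t k ≤ (∑ k, C k) * T := by
    filter_upwards [eventually_all.2 hC] with T hT
    rw [Finset.sum_comm, Finset.sum_mul]
    exact Finset.sum_le_sum fun k _ => hT k
  obtain ⟨T, hT0, hT⟩ :=
    exists_le_mul_of_eventually_sum_range_le (Finset.sum_nonneg fun k _ => hQ 0 k) htotal hε
  exact ⟨T, hT0, fun k =>
    (Finset.single_le_sum (fun k _ => hQ T k) (Finset.mem_univ k)).trans hT⟩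

variable {π} in
lemma max_mean_sub_mem_regionP (hq₀ : ∀ k, 0 ≤ q₀ k) {A : ArrivalLaw M.N}
    (h : S.StronglyStable A q₀ π) {ε : ℝ} (hε : 0 < ε) :
    (fun k => max (A.mean k - ε) 0) ∈ M.regionP := by
  obtain ⟨T, hT0, hT⟩ := S.exists_forall_expectedQueue_le hq₀ h hε
  have hT0 : (0 : ℝ) < T := Nat.cast_pos.2 hT0
  have haverage : ∑ t ∈ Finset.range T, (T : ℝ)⁻¹ • S.expectedRate π q₀ A t ∈ M.regionP :=
    M.convex_regionP.sum_mem (fun _ _ => by positivity) (by simp [hT0.ne'])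
      fun t _ => S.expectedRate_mem_regionP π A t
  refine mem_regionP_of_le haverage (fun k => le_max_right _ _) fun k =>
    max_le ?_ (nonneg_of_mem_regionP haverage k)
  rw [← Finset.smul_sum, Pi.smul_apply, Finset.sum_apply, smul_eq_mul, ← div_eq_inv_mul,
    le_div_iff₀ hT0]
  linarith [S.mul_mean_sub_sum_expectedRate_le π hq₀ A T k, hT k]

variable {S} in
theorem mean_mem_regionP_of_stabilizable (hq₀ : ∀ k, 0 ≤ q₀ k) {A : ArrivalLaw M.N}
    (h : S.Stabilizable q₀ A) : A.mean ∈ M.regionP := by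
  obtain ⟨π, hπ⟩ := h
  have hlim : Tendsto (fun (ε : ℝ) k => max (A.mean k - ε) 0) (𝓝[>] 0) (𝓝 A.mean) :=
    ((by fun_prop : Continuous fun (ε : ℝ) k => max (A.mean k - ε) 0).tendsto' 0 A.mean
      (by ext k; simpa using A.mean_nonneg k)).mono_left nhdsWithin_le_nhds
  exact M.isClosed_regionP.mem_of_tendsto hlim
    (eventually_nhdsWithin_of_forall fun ε hε => S.max_mean_sub_mem_regionP hq₀ hπ hε)

/-! ### Sufficiency -/

lemma exists_integral_queue_sq_succ_le (hq₀ : ∀ k, 0 ≤ q₀ k) (A : ArrivalLaw M.N) :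
    ∃ D : ℝ, ∀ t k, ∫ ω, S.queue π q₀ ω (t + 1) k ^ 2 ∂pathLaw A
      ≤ ∫ ω, S.queue π q₀ ω t k ^ 2 ∂pathLaw A + D
        + 2 * (S.expectedQueue π q₀ A t k * A.mean k)
        - 2 * ∫ ω, S.queue π q₀ ω t k * M.meanRate (S.active π q₀ ω t) k ∂pathLaw A := by
  obtain ⟨C, hC⟩ := exists_ae_arrival_mem_Icc (M := M) A
  refine ⟨(M.d * M.R) ^ 2 + C ^ 2, fun t k => ?_⟩
  have hqueue := S.integrable_queue π hq₀ A t k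
  have hsq : Integrable (fun ω => S.queue π q₀ ω t k ^ 2 + ((M.d * M.R) ^ 2 + C ^ 2))
      (pathLaw A) := (S.integrable_queue_pow π hq₀ A t k 2).add (integrable_const _)
  have hoffered := (S.integrable_mul_offered π q₀ A t k hqueue).const_mul 2
  have harrival := (integrable_mul_arrival A t k hqueue).const_mul 2
  have hsum : Integrable (fun ω => S.queue π q₀ ω t k ^ 2 + ((M.d * M.R) ^ 2 + C ^ 2)
      + 2 * (S.queue π q₀ ω t k * (ω t).1 k)) (pathLaw A) := hsq.add harrival
  have hupdate (ω : ℕ → M.Slot) (x : M.Slot) :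
      S.queue π q₀ (Function.update ω t x) t k = S.queue π q₀ ω t k := by rw [queue_update]
  calc ∫ ω, S.queue π q₀ ω (t + 1) k ^ 2 ∂pathLaw A
      ≤ ∫ ω, S.queue π q₀ ω t k ^ 2 + ((M.d * M.R) ^ 2 + C ^ 2)
          + 2 * (S.queue π q₀ ω t k * (ω t).1 k)
          - 2 * (S.queue π q₀ ω t k * S.offered π q₀ ω t k) ∂pathLaw A := by
        refine integral_mono_ae (S.integrable_queue_pow π hq₀ A (t + 1) k 2)
          (hsum.sub hoffered) ?_
        filter_upwards [hC] with ω hω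
        have hB : S.offered π q₀ ω t k ∈ Set.Icc 0 (M.d * M.R) := S.service_mem_Icc _ _ _
        rw [queue_succ]
        linarith [sq_max_sub_zero_add_le (S.queue_mem_Icc π hq₀ hω t k).1 hB.1 (hω t k).1,
          pow_le_pow_left₀ hB.1 hB.2 2, pow_le_pow_left₀ (hω t k).1 (hω t k).2 2]
    _ = _ := by
        rw [integral_sub hsum hoffered, integral_add hsq harrival,
          integral_add (S.integrable_queue_pow π hq₀ A t k 2) (integrable_const _),
          integral_const_mul, integral_const_mul, integral_mul_arrival A t k hqueue hupdate,
          S.integral_mul_offered π q₀ A t k hqueue hupdate, integral_const, probReal_univ,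
          one_smul, expectedQueue]

end IAScheme

end SymmetricSystem

lemma exists_measurable_argmax {X ι : Type*} [MeasurableSpace X] [MeasurableSpace ι] [Countable ι]
    [MeasurableSingletonClass ι] {f : ι → X → ℝ} (hf : ∀ i, Measurable (f i)) {s : Finset ι}
    (hs : s.Nonempty) : ∃ g : X → ι, Measurable g ∧ ∀ x, ∀ i ∈ s, f i x ≤ f (g x) x := by
  classical
  induction hs using Finset.Nonempty.cons_induction with
  | singleton i => exact ⟨fun _ => i, measurable_const, by simp⟩
  | cons i s hi _ ih =>
    obtain ⟨g, hg, hmax⟩ := ih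
    have hfg : Measurable fun x => f (g x) x :=
      (measurable_from_prod_countable_right (f := fun p : ι × X => f p.1 p.2) hf).comp
        (hg.prodMk measurable_id)
    refine ⟨fun x => if f (g x) x ≤ f i x then i else g x,
      Measurable.ite (measurableSet_le hfg (hf i)) measurable_const hg, fun x j hj => ?_⟩
    have hgj : j = i ∨ f j x ≤ f (g x) x := (Finset.mem_cons.1 hj).imp_right (hmax x j)
    grind

namespace SymmetricSystem

lemma exists_measurable_maxWeight (M : SymmetricSystem) :
    ∃ g : (Fin M.N → ℝ) → Finset (Fin M.N), Measurable g ∧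
      ∀ q, ∀ x ∈ M.regionP, ∑ k, q k * x k ≤ ∑ k, q k * M.meanRate (g q) k := by
  obtain ⟨g, hg, hmax⟩ := exists_measurable_argmax
    (f := fun ℒ (q : Fin M.N → ℝ) => ∑ k, q k * M.meanRate ℒ k) (fun ℒ => by fun_prop)
    (Finset.univ_nonempty (α := Finset (Fin M.N)))
  refine ⟨g, hg, fun q x hx => ?_⟩
  have hlin : IsLinearMap ℝ fun x : Fin M.N → ℝ => ∑ k, q k * x k :=
    ⟨dotProduct_add q, fun c => dotProduct_smul c q⟩
  exact regionP_subset (convex_halfSpace_le hlin _) (isClosed_le (by fun_prop) continuous_const)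
    (fun ℒ => hmax q ℒ (Finset.mem_univ _)) hx

variable {M : SymmetricSystem}

namespace IAScheme

variable (S : M.IAScheme) {q₀ : Fin M.N → ℝ}

/-- Max-weight scheduling: in every slot the policy activates a set of pairs whose mean service has
the largest inner product with the queue lengths. By linearity the comparison with all active sets
extends to all of `Λ_P`. -/
def IsMaxWeight (q₀ : Fin M.N → ℝ) (π : Policy M.N) : Prop :=
  ∀ ω t, ∀ x ∈ M.regionP, ∑ k, S.queue π q₀ ω t k * x k
    ≤ ∑ k, S.queue π q₀ ω t k * M.meanRate (S.active π q₀ ω t) k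

variable (q₀) in
lemma exists_isMaxWeight : ∃ π, S.IsMaxWeight q₀ π := by
  obtain ⟨g, hg, hmax⟩ := M.exists_measurable_maxWeight
  exact ⟨⟨fun t h _ => g (h (Fin.last t)), fun t => hg.comp (by fun_prop)⟩,
    fun ω t => hmax (S.queue _ q₀ ω t)⟩

variable {S} {π : Policy M.N}

lemma IsMaxWeight.sum_expectedQueue_mul_le (hπ : S.IsMaxWeight q₀ π) (hq₀ : ∀ k, 0 ≤ q₀ k)
    (A : ArrivalLaw M.N) {x : Fin M.N → ℝ} (hx : x ∈ M.regionP) (t : ℕ) :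
    ∑ k, S.expectedQueue π q₀ A t k * x k
      ≤ ∑ k, ∫ ω, S.queue π q₀ ω t k * M.meanRate (S.active π q₀ ω t) k ∂pathLaw A := by
  have hqueue (k : Fin M.N) := S.integrable_queue π hq₀ A t k
  have hrate (k : Fin M.N) := S.integrable_mul_meanRate_active π q₀ A t k (hqueue k)
  simp only [expectedQueue, ← integral_mul_const]
  rw [← integral_finsetSum _ fun k _ => (hqueue k).mul_const _,
    ← integral_finsetSum _ fun k _ => hrate k]
  exact integral_mono (integrable_finsetSum _ fun k _ => (hqueue k).mul_const _)
    (integrable_finsetSum _ fun k _ => hrate k) fun ω => hπ ω t x hx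

/-- The expectation `∑ₖ 𝔼 q_k(t)²` of the quadratic Lyapunov function. -/
def lyapunov (S : M.IAScheme) (π : Policy M.N) (q₀ : Fin M.N → ℝ) (A : ArrivalLaw M.N) (t : ℕ) :
    ℝ :=
  ∑ k, ∫ ω, S.queue π q₀ ω t k ^ 2 ∂pathLaw A

lemma lyapunov_nonneg (A : ArrivalLaw M.N) (t : ℕ) : 0 ≤ S.lyapunov π q₀ A t :=
  Finset.sum_nonneg fun _ _ => integral_nonneg fun _ => sq_nonneg _

lemma IsMaxWeight.exists_lyapunov_succ_add_le (hπ : S.IsMaxWeight q₀ π) (hq₀ : ∀ k, 0 ≤ q₀ k)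
    (A : ArrivalLaw M.N) {ε : ℝ} (h : (fun k => A.mean k + ε) ∈ M.regionP) :
    ∃ D : ℝ, ∀ t, S.lyapunov π q₀ A (t + 1) + 2 * ε * ∑ k, S.expectedQueue π q₀ A t k
      ≤ S.lyapunov π q₀ A t + D := by
  obtain ⟨D, hD⟩ := S.exists_integral_queue_sq_succ_le π hq₀ A
  refine ⟨∑ _k : Fin M.N, D, fun t => ?_⟩
  have hdrift := Finset.sum_le_sum fun k (_ : k ∈ Finset.univ) => hD t k
  simp only [Finset.sum_sub_distrib, Finset.sum_add_distrib, ← Finset.mul_sum] at hdrift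
  have hweight := hπ.sum_expectedQueue_mul_le hq₀ A h t
  simp only [mul_add, Finset.sum_add_distrib, ← Finset.sum_mul] at hweight
  unfold lyapunov
  linarith

lemma IsMaxWeight.stronglyStable (hπ : S.IsMaxWeight q₀ π) (hq₀ : ∀ k, 0 ≤ q₀ k)
    (A : ArrivalLaw M.N) {ε : ℝ} (hε : 0 < ε) (h : (fun k => A.mean k + ε) ∈ M.regionP) :
    S.StronglyStable A q₀ π := by
  obtain ⟨D, hD⟩ := hπ.exists_lyapunov_succ_add_le hq₀ A h
  refine (S.stronglyStable_iff π hq₀ A).2 fun k => ⟨(S.lyapunov π q₀ A 0 + D) / (2 * ε), ?_⟩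
  filter_upwards [eventually_ge_atTop 1] with T hT
  have hsum : ∑ t ∈ Finset.range T, S.expectedQueue π q₀ A t k
      ≤ ∑ t ∈ Finset.range T, ∑ k, S.expectedQueue π q₀ A t k :=
    Finset.sum_le_sum fun t _ => Finset.single_le_sum
      (fun k _ => S.expectedQueue_nonneg π hq₀ A t k) (Finset.mem_univ k)
  have htelescope := add_sum_range_le_of_forall_succ hD T
  rw [← Finset.mul_sum] at htelescope
  have hinitial : S.lyapunov π q₀ A 0 ≤ S.lyapunov π q₀ A 0 * T :=
    le_mul_of_one_le_right (lyapunov_nonneg A 0) (Nat.one_le_cast.2 hT)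
  rw [div_mul_eq_mul_div, le_div_iff₀' (by positivity)]
  calc 2 * ε * ∑ t ∈ Finset.range T, S.expectedQueue π q₀ A t k
      ≤ 2 * ε * ∑ t ∈ Finset.range T, ∑ k, S.expectedQueue π q₀ A t k := by gcongr
    _ ≤ (S.lyapunov π q₀ A 0 + D) * T := by
        linarith [lyapunov_nonneg (S := S) (π := π) (q₀ := q₀) A T]

variable (S)

theorem mem_stabilityRegion_of_regionP_mem_nhdsWithin (hq₀ : ∀ k, 0 ≤ q₀ k) {a : Fin M.N → ℝ}
    (ha : ∀ k, 0 ≤ a k) (h : M.regionP ∈ 𝓝[{b | ∀ k, 0 ≤ b k}] a) :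
    a ∈ S.stabilityRegion q₀ := by
  obtain ⟨ε, hε, hmem⟩ := exists_add_mem_regionP ha h
  obtain ⟨π, hπ⟩ := S.exists_isMaxWeight q₀
  exact ⟨ha, fun A hA => ⟨π, hπ.stronglyStable hq₀ A hε (hA ▸ hmem)⟩⟩

lemma stabilityRegion_subset_regionP (hq₀ : ∀ k, 0 ≤ q₀ k) :
    S.stabilityRegion q₀ ⊆ M.regionP := fun a ha => by
  rw [← ArrivalLaw.mean_dirac a ha.1]
  exact mean_mem_regionP_of_stabilizable hq₀ (ha.2 _ (ArrivalLaw.mean_dirac a ha.1))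

theorem closure_stabilityRegion (hq₀ : ∀ k, 0 ≤ q₀ k) :
    closure (S.stabilityRegion q₀) = M.regionP := by
  refine (closure_minimal (S.stabilityRegion_subset_regionP hq₀) M.isClosed_regionP).antisymm
    fun a ha => ?_
  have hlim : Tendsto (fun δ : ℝ => (1 - δ) • a) (𝓝[>] 0) (𝓝 a) :=
    ((by fun_prop : Continuous fun δ : ℝ => (1 - δ) • a).tendsto' 0 a (by simp)).mono_left
      nhdsWithin_le_nhds
  refine mem_closure_of_tendsto hlim ?_
  filter_upwards [Ioo_mem_nhdsGT (zero_lt_one (α := ℝ))] with δ hδ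
  exact S.mem_stabilityRegion_of_regionP_mem_nhdsWithin hq₀
    (smul_nonneg (sub_nonneg.2 hδ.2.le) (nonneg_of_mem_regionP ha))
    (regionP_mem_nhdsWithin_smul ha hδ.1 hδ.2.le)

end IAScheme

end SymmetricSystem

end

end IAStability

theorem mainTheorem2 (M : IAStability.SymmetricSystem) (S : M.IAScheme)
    (q₀ : Fin M.N → ℝ) (hq₀ : ∀ k, 0 ≤ q₀ k) :
    closure (S.stabilityRegion q₀) = M.regionP ∧
    (∀ a : Fin M.N → ℝ, (∀ k, 0 ≤ a k) → M.regionP ∈ 𝓝[{b | ∀ k, 0 ≤ b k}] a →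
      a ∈ S.stabilityRegion q₀) ∧
    (∀ A : IAStability.ArrivalLaw M.N, S.Stabilizable q₀ A → A.mean ∈ M.regionP) :=
  ⟨S.closure_stabilityRegion hq₀,
    fun _ ha h => S.mem_stabilityRegion_of_regionP_mem_nhdsWithin hq₀ ha h,
    fun _ h => IAStability.SymmetricSystem.IAScheme.mean_mem_regionP_of_stabilizable hq₀ h⟩
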